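/- Let $M$ be a (finite-dimensional, Hausdorff) smooth manifold and $L\to M$ a real line bundle. An \emph{abstract Jacobi structure} $J=\{-,-\}$ on $(M,L)$ is a Lie bracket on $\Gamma(L)$ which is a first order differential operator in each entry. Let $J^1L$ be the first jet bundle of $L$ and $\operatorname{der}L$ the bundle whose fibre $\operatorname{der}_xL$ consists of the linear maps $\delta:\Gamma(L)\to L_x$ for which there is a vector $\sigma(\delta)\in T_xM$ (the symbol of $\delta$) with $\delta(f\lambda)=f(x)\,\delta\lambda+\sigma(\delta)(f)\,\lambda_x$ for all $f\in C^\infty(M)$, $\lambda\in\Gamma(L)$. Let $\gamma:T^*M\otimes L\hookrightarrow J^1L$ be the co-symbol, $\gamma(df\otimes\lambda)=j^1(f\lambda)-f\,j^1\lambda$. Let $\widehat\Lambda_J:J^1L\times_M J^1L\to L$ be the bilinear form with $\widehat\Lambda_J(j^1\lambda,j^1\mu)=\{\lambda,\mu\}$, let $\widehat\Lambda_J^\sharp:J^1L\to\operatorname{der}L$ be given by $\widehat\Lambda_J^\sharp(\alpha)\lambda=\widehat\Lambda_J(\alpha,j^1\lambda)$, and put $\Lambda_J^\sharp=\sigma\circ\widehat\Lambda_J^\sharp\circ\gamma:T^*M\otimes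 L\to TM$; equivalently $\langle\Lambda_J^\sharp(\eta\otimes\lambda),\theta\rangle\mu=\widehat\Lambda_J(\gamma(\eta\otimes\lambda),\gamma(\theta\otimes\mu))$. A \emph{Jacobi algebroid} $(A,L)$ over $M$ is a Lie algebroid $A\to M$, with anchor $\rho$ and bracket $[-,-]$, together with a flat $A$-connection $\nabla:A\to\operatorname{der}L$ in the line bundle $L$. The Jacobi structure makes $(J^1L,L)$ a Jacobi algebroid, namely the unique one with $\rho(j^1\lambda)=\sigma(\{\lambda,-\})$, $[j^1\lambda,j^1\mu]=j^1\{\lambda,\mu\}$ and $\nabla_{j^1\lambda}\mu=\{\lambda,\mu\}$ for all $\lambda,\mu\in\Gamma(L)$. Let $S\subset M$ be an embedded submanifold and $\ell=L|_S$. A \emph{Jacobi subalgebroid of $(A,L)$ over $S$} is a pair $(B,\ell)$, where $B\to S$ is a smooth vector subbundle of $A|_S$, such that (i) $\rho$ restricts to a vector bundle morphism $B\to TS$; (ii) for all $\beta,\beta'\in\Gamma(B)$ there is $[\beta,\beta']_B\in\Gamma(B)$ such that, whenever $\alpha,\alpha'\in\Gamma(A)$ satisfy $\alpha|_S=\beta$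 and $\alpha'|_S=\beta'$, one has $[\alpha,\alpha']|_S=[\beta,\beta']_B$; (iii) $\nabla$ descends to a vector bundle morphism $\nabla|_\ell:B\to\operatorname{der}\ell$, i.e. $\nabla_b\lambda=(\nabla|_\ell)_b(\lambda|_S)$ for all $b\in B$ and $\lambda\in\Gamma(L)$. The submanifold $S$ is \emph{coisotropic} if $\Lambda_J^\sharp(T_x^0S\otimes L_x)\subset T_xS$ for every $x\in S$, where $T_x^0S\subset T_x^*M$ is the annihilator of $T_xS$. Let $N_\ell{}^*S=N^*S\otimes\ell$, where $N^*S=T^0S$ is the conormal bundle, regarded as the subbundle $\gamma(N^*S\otimes\ell)$ of $J^1L|_S$. Proposition. The submanifold $S$ is coisotropic if and only if $(N_\ell{}^*S,\ell)$ is a Jacobi subalgebroid of the Jacobi algebroid $(J^1L,L)$. -/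

import Mathlib

set_option linter.unusedSectionVars false

open scoped Manifold ContDiff Topology Bundle
open Bundle

noncomputable section
namespace Jac


section Calculus
variable {E : Type*} [NormedAddCommGroup E] [NormedSpace ℝ E] [FiniteDimensional ℝ E]

theorem contDiff_param_aux (n : ℕ) : ∀ F : E × ℝ → ℝ, ContDiff ℝ ∞ F →
    ContDiff ℝ n (fun t => ∫ s in (0 : ℝ)..1, F (t, s)) := by
  have key : ∀ F : E × ℝ → ℝ, ContDiff ℝ ∞ F → ∀ t, HasFDerivAt (fun t => ∫ s in (0 : ℝ)..1, F (t, s))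
      (∫ s in (0 : ℝ)..1, (fderiv ℝ F (t, s)).comp (ContinuousLinearMap.inl ℝ E ℝ)) t := by
    intro F hF t
    have hF' : Continuous fun p : E × ℝ => (fderiv ℝ F p).comp (ContinuousLinearMap.inl ℝ E ℝ) :=
      (hF.continuous_fderiv (by simp)).clm_comp continuous_const
    have hc : Continuous F := hF.continuous
    obtain ⟨C, hC⟩ := ((isCompact_closedBall t 1).prod (isCompact_Icc (a := (0 : ℝ)) (b := 1))).exists_bound_of_continuousOn
      hF'.continuousOn
    refine (intervalIntegral.hasFDerivAt_integral_of_dominated_of_fderiv_le (F := fun t s => F (t, s))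
      (F' := fun t s => (fderiv ℝ F (t, s)).comp (ContinuousLinearMap.inl ℝ E ℝ)) (bound := fun _ => C)
      (s := Metric.ball t 1) (Metric.ball_mem_nhds t one_pos) ?_ ?_ ?_ ?_ ?_ ?_)
    · exact Filter.Eventually.of_forall fun x => (hc.comp (by fun_prop)).aestronglyMeasurable
    · exact (hc.comp (by fun_prop)).intervalIntegrable _ _
    · exact (hF'.comp (by fun_prop : Continuous fun s : ℝ => (t, s))).aestronglyMeasurable
    · refine Filter.Eventually.of_forall fun s hs x hx => hC (x, s) ⟨Metric.ball_subset_closedBall hx, ?_⟩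
      rw [Set.uIoc_of_le zero_le_one] at hs
      exact ⟨hs.1.le, hs.2⟩
    · exact intervalIntegrable_const
    · refine Filter.Eventually.of_forall fun s hs x hx => ?_
      have h1 : HasFDerivAt F (fderiv ℝ F (x, s)) (x, s) :=
        (hF.differentiable (by simp) _).hasFDerivAt
      exact h1.comp x (hasFDerivAt_prodMk_left x s)
  induction n with
  | zero =>
    intro F hF
    exact contDiff_zero.2 (continuous_iff_continuousAt.2 fun t => (key F hF t).continuousAt)
  | succ n ih =>
    intro F hF
    push_cast
    refine contDiff_succ_iff_fderiv_apply.2 ⟨fun t => (key F hF t).differentiableAt, by simp, fun v => ?_⟩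
    have : (fun t => fderiv ℝ (fun t => ∫ s in (0 : ℝ)..1, F (t, s)) t v) =
        fun t => ∫ s in (0 : ℝ)..1, (fun p => fderiv ℝ F p (v, 0)) (t, s) := by
      funext t
      rw [(key F hF t).fderiv, ContinuousLinearMap.intervalIntegral_apply]
      · simp
      · refine Continuous.intervalIntegrable ?_ _ _
        exact ((hF.continuous_fderiv (by simp)).comp (by fun_prop : Continuous fun s : ℝ => (t, s))).clm_comp continuous_const
    rw [this]
    exact ih _ ((hF.fderiv_right (m := ∞) (by simp)).clm_apply contDiff_const)

theorem contDiff_param (F : E × ℝ → ℝ) (hF : ContDiff ℝ ∞ F) :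
    ContDiff ℝ ∞ (fun t => ∫ s in (0 : ℝ)..1, F (t, s)) :=
  contDiff_infty.2 fun n => contDiff_param_aux n F hF

/-- Hadamard's lemma to second order. -/
theorem hadamard (h : E → ℝ) (hh : ContDiff ℝ ∞ h) (p : E) (h0 : h p = 0) (h1 : fderiv ℝ h p = 0) :
    ∃ k : Fin (Module.finrank ℝ E) → E → ℝ, (∀ i, ContDiff ℝ ∞ (k i)) ∧ (∀ i, k i p = 0) ∧
      ∀ t, h t = ∑ i, (Module.finBasis ℝ E).coord i (t - p) * k i t := by
  set b := Module.finBasis ℝ E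
  refine ⟨fun i t => ∫ s in (0 : ℝ)..1, fderiv ℝ h (p + s • (t - p)) (b i), fun i => ?_, fun i => ?_, fun t => ?_⟩
  · refine contDiff_param (fun q : E × ℝ => fderiv ℝ h (p + q.2 • (q.1 - p)) (b i)) ?_
    exact ((hh.fderiv_right (m := ∞) (by simp)).comp (by fun_prop)).clm_apply contDiff_const
  · simp [h1]
  · have hd : ∀ s : ℝ, HasDerivAt (fun s : ℝ => h (p + s • (t - p))) (fderiv ℝ h (p + s • (t - p)) (t - p)) s := by
      intro s
      have h2 : HasDerivAt (fun s : ℝ => p + s • (t - p)) (t - p) s := by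
        simpa using ((hasDerivAt_id s).smul_const (t - p)).const_add p
      exact (hh.differentiable (by simp) _).hasFDerivAt.comp_hasDerivAt s h2
    have hcont : ∀ v, Continuous fun s : ℝ => fderiv ℝ h (p + s • (t - p)) v := fun v =>
      ((hh.continuous_fderiv (by simp)).comp (by fun_prop)).clm_apply continuous_const
    have := intervalIntegral.integral_eq_sub_of_hasDerivAt (a := 0) (b := 1) (fun s _ => hd s)
      ((hcont _).intervalIntegrable _ _)
    simp only [one_smul, add_sub_cancel, zero_smul, add_zero, h0, sub_zero] at this
    rw [← this]
    simp_rw [← intervalIntegral.integral_const_mul]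
    rw [← intervalIntegral.integral_finsetSum fun i _ => ((hcont _).const_mul _ |>.intervalIntegrable _ _)]
    congr 1
    funext s
    have hA : ∀ A : E →L[ℝ] ℝ, A (t - p) = ∑ i, b.coord i (t - p) * A (b i) := by
      intro A
      conv_lhs => rw [← b.sum_repr (t - p)]
      simp [map_sum, -Module.Basis.sum_repr]
    exact hA _

end Calculus

section Manifold

variable {E : Type*} [NormedAddCommGroup E] [NormedSpace ℝ E]
  {M : Type*} [TopologicalSpace M] [ChartedSpace E M]

/-- The differential `d_x f : T_x M → ℝ` of a smooth function. -/
def dAt (f : C^∞⟮𝓘(ℝ, E), M; ℝ⟯) (x : M) : TangentSpace 𝓘(ℝ, E) x →L[ℝ] ℝ :=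
  mfderiv 𝓘(ℝ, E) 𝓘(ℝ, ℝ) f x

theorem dAt_add (f g : C^∞⟮𝓘(ℝ, E), M; ℝ⟯) (x : M) : dAt (f + g) x = dAt f x + dAt g x :=
  mfderiv_add (f.contMDiff.mdifferentiable (by simp) x) (g.contMDiff.mdifferentiable (by simp) x)

theorem dAt_mul (f g : C^∞⟮𝓘(ℝ, E), M; ℝ⟯) (x : M) :
    dAt (f * g) x = f x • dAt g x + g x • dAt f x :=
  ((f.contMDiff.mdifferentiable (by simp) x).hasMFDerivAt.mul
    (g.contMDiff.mdifferentiable (by simp) x).hasMFDerivAt).mfderiv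

theorem dAt_congr {f g : C^∞⟮𝓘(ℝ, E), M; ℝ⟯} {x : M} (h : ∀ᶠ y in 𝓝 x, f y = g y) :
    dAt f x = dAt g x := Filter.EventuallyEq.mfderiv_eq h

theorem dAt_smul (c : ℝ) (f : C^∞⟮𝓘(ℝ, E), M; ℝ⟯) (x : M) : dAt (c • f) x = c • dAt f x :=
  const_smul_mfderiv (f.contMDiff.mdifferentiable (by simp) x) c

theorem dAt_eq_fderiv (f : C^∞⟮𝓘(ℝ, E), M; ℝ⟯) (x : M) :
    dAt f x = fderiv ℝ (fun t => f ((extChartAt 𝓘(ℝ, E) x).symm t)) (extChartAt 𝓘(ℝ, E) x x) := by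
  rw [dAt, (f.contMDiff.mdifferentiable (by simp) x).mfderiv]
  simp only [modelWithCornersSelf_coe, Set.range_id, fderivWithin_univ]
  rfl

/-- The ideal `𝔪_x` of smooth functions vanishing at `x`. -/
def vanishingIdeal (x : M) : Ideal C^∞⟮𝓘(ℝ, E), M; ℝ⟯ where
  carrier := {f | f x = 0}
  add_mem' {f g} hf hg := by simp_all
  zero_mem' := by simp
  smul_mem' c f hf := by simp_all

@[simp] theorem mem_vanishingIdeal {x : M} {f : C^∞⟮𝓘(ℝ, E), M; ℝ⟯} :
    f ∈ vanishingIdeal x ↔ f x = 0 := Iff.rfl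

variable [FiniteDimensional ℝ E] [IsManifold 𝓘(ℝ, E) ∞ M] [T2Space M]

theorem exists_bump (x : M) {U : Set M} (hU : U ∈ 𝓝 x) :
    ∃ χ : C^∞⟮𝓘(ℝ, E), M; ℝ⟯, (∀ᶠ y in 𝓝 x, χ y = 1) ∧ tsupport χ ⊆ U := by
  obtain ⟨f, -, hf⟩ := (SmoothBumpFunction.nhds_basis_tsupport (I := 𝓘(ℝ, E)) x).mem_iff.1 hU
  exact ⟨⟨f, f.contMDiff⟩, f.eventuallyEq_one, hf⟩

theorem mem_sq_of_eventually_zero {x : M} {f : C^∞⟮𝓘(ℝ, E), M; ℝ⟯} (h : ∀ᶠ y in 𝓝 x, f y = 0) :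
    f ∈ vanishingIdeal x ^ 2 := by
  obtain ⟨χ, h1, h2⟩ := exists_bump (E := E) x h
  have : f = (1 - χ) * f := by
    ext y
    by_cases hy : y ∈ tsupport χ
    · have := h2 hy
      simp only [Set.mem_ofPred_eq] at this
      simp [this]
    · simp [image_eq_zero_of_notMem_tsupport hy]
  rw [this, sq]
  exact Ideal.mul_mem_mul (by simp [h1.self_of_nhds]) h.self_of_nhds

theorem exists_fn_of_chart (x : M) (h : E → ℝ) (hh : ContDiff ℝ ∞ h) :
    ∃ f : C^∞⟮𝓘(ℝ, E), M; ℝ⟯, ∀ᶠ y in 𝓝 x, f y = h (extChartAt 𝓘(ℝ, E) x y) := by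
  let ψ : SmoothBumpFunction 𝓘(ℝ, E) x := Classical.choice inferInstance
  refine ⟨⟨fun y => ψ y • h (extChartAt 𝓘(ℝ, E) x y), ψ.contMDiff_smul ?_⟩, ?_⟩
  · exact hh.contMDiff.comp_contMDiffOn (contMDiffOn_extChartAt)
  · filter_upwards [ψ.eventuallyEq_one] with y hy
    simp [hy]

theorem exists_chart_of_fn (x : M) (f : C^∞⟮𝓘(ℝ, E), M; ℝ⟯) :
    ∃ h : E → ℝ, ContDiff ℝ ∞ h ∧ (∀ᶠ y in 𝓝 x, f y = h (extChartAt 𝓘(ℝ, E) x y)) ∧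
      h =ᶠ[𝓝 (extChartAt 𝓘(ℝ, E) x x)] fun t => f ((extChartAt 𝓘(ℝ, E) x).symm t) := by
  set φ := extChartAt 𝓘(ℝ, E) x
  have ht : φ.target ∈ 𝓝 (φ x) := extChartAt_target_mem_nhds x
  obtain ⟨χ, h1, h2⟩ := exists_bump (E := E) (M := E) (φ x) ht
  have hsm : ContMDiffOn 𝓘(ℝ, E) 𝓘(ℝ, ℝ) ∞ (fun t => f (φ.symm t)) φ.target :=
    f.contMDiff.comp_contMDiffOn (contMDiffOn_extChartAt_symm x)
  have hev : (fun t => χ t • f (φ.symm t)) =ᶠ[𝓝 (φ x)] fun t => f (φ.symm t) := by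
    filter_upwards [h1] with t ht
    simp [ht]
  refine ⟨fun t => χ t • f (φ.symm t), ?_, ?_, hev⟩
  · rw [← contMDiff_iff_contDiff]
    refine contMDiff_of_tsupport fun t ht => ?_
    have ht2 : t ∈ φ.target := h2 (tsupport_smul_subset_left _ _ ht)
    exact χ.contMDiff.contMDiffAt.smul (hsm.contMDiffAt ((isOpen_extChartAt_target x).mem_nhds ht2))
  · filter_upwards [(continuousAt_extChartAt x).eventually hev, extChartAt_source_mem_nhds (I := 𝓘(ℝ, E)) x] with y hy hs
    rw [hy, φ.left_inv hs]

theorem mem_sq_of_dAt_eq_zero {x : M} {f : C^∞⟮𝓘(ℝ, E), M; ℝ⟯} (h0 : f x = 0) (h1 : dAt f x = 0) :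
    f ∈ vanishingIdeal x ^ 2 := by
  set φ := extChartAt 𝓘(ℝ, E) x
  obtain ⟨h, hh, hf, hg⟩ := exists_chart_of_fn x f
  obtain ⟨k, hk, hk0, hk1⟩ := hadamard h hh (φ x) (by rw [← hf.self_of_nhds, h0])
    ((hg.fderiv_eq.trans (dAt_eq_fderiv f x).symm).trans h1)
  choose A hA using fun i => exists_fn_of_chart (M := M) x
    (fun t => (Module.finBasis ℝ E).coord i (t - φ x)) (((Module.finBasis ℝ E).coord i).toContinuousLinearMap.contDiff.comp
      (contDiff_id.sub contDiff_const))
  choose B hB using fun i => exists_fn_of_chart (M := M) x (k i) (hk i)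
  have h3 : f = (f - ∑ i, A i * B i) + ∑ i, A i * B i := by ring
  rw [h3]
  refine add_mem (mem_sq_of_eventually_zero ?_) (sum_mem fun i _ => ?_)
  · filter_upwards [hf, Filter.eventually_all.2 hA, Filter.eventually_all.2 hB] with y h1 h2 h3
    have : (∑ i, A i * B i : C^∞⟮𝓘(ℝ, E), M; ℝ⟯) y = ∑ i, A i y * B i y :=
      map_sum (ContMDiffMap.evalRingHom (I := 𝓘(ℝ, E)) (I' := 𝓘(ℝ, ℝ)) (n := ∞) (R := ℝ) y) (fun i => A i * B i) Finset.univ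
    simp only [ContMDiffMap.coe_sub, Pi.sub_apply, this, h1, hk1, h2, h3]
    simp [φ]
  · rw [sq]
    refine Ideal.mul_mem_mul ?_ ?_
    · simp [(hA i).self_of_nhds, φ]
    · rw [mem_vanishingIdeal, (hB i).self_of_nhds]
      exact hk0 i

theorem exists_dAt_eq (x : M) (ξ : TangentSpace 𝓘(ℝ, E) x →L[ℝ] ℝ) :
    ∃ f : C^∞⟮𝓘(ℝ, E), M; ℝ⟯, f x = 0 ∧ dAt f x = ξ := by
  let ξ' : E →L[ℝ] ℝ := ξ
  set φ := extChartAt 𝓘(ℝ, E) x with hφ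
  obtain ⟨f, hf⟩ := exists_fn_of_chart x (fun t => ξ' (t - φ x)) (ξ'.contDiff.comp
      (contDiff_id.sub contDiff_const))
  refine ⟨f, by simp [hf.self_of_nhds, φ], ?_⟩
  rw [dAt_eq_fderiv]
  have h1 : (fun t => f (φ.symm t)) =ᶠ[𝓝 (φ x)] fun t => ξ' (t - φ x) := by
    filter_upwards [(continuousAt_extChartAt_symm x).eventually (p := fun y => f y = ξ' (φ y - φ x)) (by rw [extChartAt_to_inv]; exact hf),
      extChartAt_target_mem_nhds (I := 𝓘(ℝ, E)) x] with t h1 h2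
    rw [h1, φ.right_inv h2]
  rw [h1.fderiv_eq]
  have : HasFDerivAt (fun t => ξ' (t - φ x)) ξ' (φ x) := by
    exact ξ'.hasFDerivAt.comp (φ x) ((hasFDerivAt_id (φ x)).sub_const (φ x))
  exact this.fderiv

theorem eq_zero_of_dAt {x : M} (v : TangentSpace 𝓘(ℝ, E) x)
    (h : ∀ f : C^∞⟮𝓘(ℝ, E), M; ℝ⟯, dAt f x v = 0) : v = 0 := by
  by_contra hv
  obtain ⟨ξ, hξ⟩ : ∃ ξ : E →L[ℝ] ℝ, ξ v ≠ 0 := by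
    by_contra! hc
    exact hv ((SeparatingDual.eq_zero_iff_forall_dual_eq_zero (R := ℝ) (V := E) v).2 hc)
  obtain ⟨f, -, hf⟩ := exists_dAt_eq (E := E) x ξ
  exact hξ (by rw [← h f, hf]; rfl)

/-- A point derivation of the algebra of smooth functions is a tangent vector. -/
theorem exists_vector_of_pointDerivation (x : M) (D : C^∞⟮𝓘(ℝ, E), M; ℝ⟯ →ₗ[ℝ] ℝ)
    (hD : ∀ f g, D (f * g) = f x * D g + g x * D f) :
    ∃ v : TangentSpace 𝓘(ℝ, E) x, ∀ f, D f = dAt f x v := by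
  have h1 : ∀ f ∈ vanishingIdeal x ^ 2, D f = 0 := by
    intro f hf
    rw [sq] at hf
    refine Submodule.mul_induction_on hf (fun a ha b hb => ?_) (fun a b ha hb => by simp [ha, hb])
    rw [mem_vanishingIdeal] at ha hb
    simp [hD, ha, hb]
  have hone : D 1 = 0 := by
    have := hD 1 1
    simp at this
    exact this
  choose t ht0 ht1 using fun ξ : E →L[ℝ] ℝ => exists_dAt_eq (E := E) x ξ
  have h2 : ∀ f g : C^∞⟮𝓘(ℝ, E), M; ℝ⟯, dAt f x = dAt g x → D f = D g := by
    intro f g hfg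
    have h3 : f - g - (f x - g x) • 1 ∈ vanishingIdeal x ^ 2 := by
      refine mem_sq_of_dAt_eq_zero (by simp) ?_
      have hd1 : dAt (1 : C^∞⟮𝓘(ℝ, E), M; ℝ⟯) x = 0 := mfderiv_const
      have e1 : f - g - (f x - g x) • 1 = f + (-1 : ℝ) • g + (-(f x - g x)) • 1 := by
        rw [neg_smul, neg_smul, one_smul, sub_eq_add_neg, sub_eq_add_neg]
      rw [e1, dAt_add, dAt_add, dAt_smul, dAt_smul, hd1, hfg]
      ext w
      change dAt g x w + (-1) * dAt g x w + _ * 0 = 0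
      ring
    have h4 := h1 _ h3
    simp only [map_sub, map_smul, hone, smul_zero, sub_zero] at h4
    exact sub_eq_zero.1 h4
  let Φ : (E →L[ℝ] ℝ) →ₗ[ℝ] ℝ :=
    { toFun := fun ξ => D (t ξ)
      map_add' := fun ξ η => by
        rw [← map_add]
        exact h2 _ _ (by rw [dAt_add, ht1, ht1, ht1]; rfl)
      map_smul' := fun c ξ => by
        rw [RingHom.id_apply, ← map_smul]
        exact h2 _ _ (by rw [dAt_smul, ht1, ht1]; rfl) }
  obtain ⟨v, hv⟩ := (Module.evalEquiv ℝ E).surjective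
    (Φ ∘ₗ (LinearMap.toContinuousLinearMap : (E →ₗ[ℝ] ℝ) ≃ₗ[ℝ] (E →L[ℝ] ℝ)).toLinearMap)
  refine ⟨v, fun f => ?_⟩
  let ξ : E →L[ℝ] ℝ := dAt f x
  have h5 : ξ v = D (t ξ) := LinearMap.congr_fun hv (ξ : E →ₗ[ℝ] ℝ)
  exact (h2 _ _ (ht1 ξ).symm).trans h5.symm

/-- Every tangent vector is the value of a global derivation of the algebra of smooth functions. -/
theorem exists_derivation (x : M) (v : TangentSpace 𝓘(ℝ, E) x) :
    ∃ D : C^∞⟮𝓘(ℝ, E), M; ℝ⟯ →ₗ[ℝ] C^∞⟮𝓘(ℝ, E), M; ℝ⟯,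
      (∀ f g, D (f * g) = f * D g + g * D f) ∧ ∀ f, D f x = dAt f x v := by
  let v' : E := v
  set φ := extChartAt 𝓘(ℝ, E) x with hφ
  let ψ : SmoothBumpFunction 𝓘(ℝ, E) x := Classical.choice inferInstance
  have hsm : ∀ f : C^∞⟮𝓘(ℝ, E), M; ℝ⟯, ContDiffOn ℝ ∞ (fun t => f (φ.symm t)) φ.target := fun f =>
    (f.contMDiff.comp_contMDiffOn (contMDiffOn_extChartAt_symm x)).contDiffOn
  have hdiff : ∀ f : C^∞⟮𝓘(ℝ, E), M; ℝ⟯, ∀ y ∈ φ.source, DifferentiableAt ℝ (fun t => f (φ.symm t)) (φ y) :=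
    fun f y hy => (((hsm f).contDiffAt ((isOpen_extChartAt_target x).mem_nhds (φ.map_source hy))).differentiableAt (by simp))
  let D : C^∞⟮𝓘(ℝ, E), M; ℝ⟯ → C^∞⟮𝓘(ℝ, E), M; ℝ⟯ := fun f =>
    ⟨fun y => ψ y • fderiv ℝ (fun t => f (φ.symm t)) (φ y) v', ψ.contMDiff_smul (by
      have h1 : ContDiffOn ℝ ∞ (fun t => fderiv ℝ (fun t => f (φ.symm t)) t v') φ.target :=
        ((hsm f).fderiv_of_isOpen (isOpen_extChartAt_target x) (by simp)).clm_apply contDiffOn_const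
      refine h1.contMDiffOn.comp (contMDiffOn_extChartAt) ?_
      intro y hy
      exact φ.map_source (by simpa [φ] using hy))⟩
  have hD : ∀ f y, D f y = ψ y * fderiv ℝ (fun t => f (φ.symm t)) (φ y) v' := fun f y => rfl
  have hψ : ∀ y, y ∉ φ.source → ψ y = 0 := fun y hy => by
    by_contra hc
    exact hy (by simpa [φ] using ψ.support_subset_source hc)
  refine ⟨{ toFun := D, map_add' := fun f g => ?_, map_smul' := fun c f => ?_ }, fun f g => ?_, fun f => ?_⟩
  · ext y
    simp only [ContMDiffMap.coe_add, Pi.add_apply, hD]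
    by_cases hy : y ∈ φ.source
    · rw [fderiv_fun_add (hdiff f y hy) (hdiff g y hy)]
      simp [mul_add]
    · simp [hψ y hy]
  · ext y
    simp only [ContMDiffMap.coe_smul, Pi.smul_apply, hD, RingHom.id_apply]
    by_cases hy : y ∈ φ.source
    · rw [fderiv_fun_const_smul (hdiff f y hy)]
      simp; ring
    · simp [hψ y hy]
  · ext y
    simp only [LinearMap.coe_mk, AddHom.coe_mk, ContMDiffMap.coe_add, ContMDiffMap.coe_mul, Pi.add_apply, Pi.mul_apply, hD]
    by_cases hy : y ∈ φ.source
    · rw [fderiv_fun_mul (hdiff f y hy) (hdiff g y hy)]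
      simp [φ.left_inv hy]; ring
    · simp [hψ y hy]
  · simp only [LinearMap.coe_mk, AddHom.coe_mk, hD]
    rw [dAt_eq_fderiv, ψ.eq_one, one_mul]
    rfl

end Manifold


section LineBundle

variable {E : Type*} [NormedAddCommGroup E] [NormedSpace ℝ E]
  {M : Type*} [TopologicalSpace M] [ChartedSpace E M]
  {L : M → Type*} [TopologicalSpace (TotalSpace ℝ L)] [∀ x, AddCommGroup (L x)]
  [∀ x, Module ℝ (L x)] [∀ x, TopologicalSpace (L x)] [FiberBundle ℝ L] [VectorBundle ℝ ℝ L]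

/-- The `C^∞(M)`-module structure on `Γ(L)`. -/
instance sectionModule : Module C^∞⟮𝓘(ℝ, E), M; ℝ⟯ Cₛ^∞⟮𝓘(ℝ, E); ℝ, L⟯ where
  smul f s := ⟨fun x => f x • s x, f.contMDiff.smul_section s.contMDiff⟩
  one_smul s := by ext x; exact one_smul ℝ (s x)
  mul_smul f g s := by ext x; exact mul_smul (f x) (g x) (s x)
  smul_zero f := by ext x; exact smul_zero (f x)
  smul_add f s t := by ext x; exact smul_add (f x) (s x) (t x)
  add_smul f g s := by ext x; exact add_smul (f x) (g x) (s x)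
  zero_smul s := by ext x; exact zero_smul ℝ (s x)

@[simp] theorem smul_section_apply (f : C^∞⟮𝓘(ℝ, E), M; ℝ⟯) (s : Cₛ^∞⟮𝓘(ℝ, E); ℝ, L⟯) (x : M) :
    (f • s) x = f x • s x := rfl

instance sectionTower :
    IsScalarTower ℝ C^∞⟮𝓘(ℝ, E), M; ℝ⟯ Cₛ^∞⟮𝓘(ℝ, E); ℝ, L⟯ where
  smul_assoc c f s := by ext x; exact smul_assoc c (f x) (s x)

instance sectionComm :
    SMulCommClass ℝ C^∞⟮𝓘(ℝ, E), M; ℝ⟯ Cₛ^∞⟮𝓘(ℝ, E); ℝ, L⟯ where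
  smul_comm c f s := by ext x; exact smul_comm c (f x) (s x)

variable (E L) in
/-- Evaluation of sections at a point. -/
def evalAt (x : M) : Cₛ^∞⟮𝓘(ℝ, E); ℝ, L⟯ →ₗ[ℝ] L x where
  toFun s := s x
  map_add' _ _ := rfl
  map_smul' _ _ := rfl

@[simp] theorem evalAt_apply (x : M) (s : Cₛ^∞⟮𝓘(ℝ, E); ℝ, L⟯) : evalAt E L x s = s x := rfl

variable (E L) in
/-- The fibre `der_x L` at `x` of the Atiyah algebroid of `L`: linear maps `δ : Γ(L) → L_x` such that
`δ(fλ) = f(x) δλ + v(f) λ(x)` for a tangent vector `v` at `x`, the symbol of `δ`. -/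
def derFiber (x : M) : Submodule ℝ (Cₛ^∞⟮𝓘(ℝ, E); ℝ, L⟯ →ₗ[ℝ] L x) where
  carrier := {δ | ∃ v : TangentSpace 𝓘(ℝ, E) x, ∀ (f : C^∞⟮𝓘(ℝ, E), M; ℝ⟯)
    (s : Cₛ^∞⟮𝓘(ℝ, E); ℝ, L⟯), δ (f • s) = f x • δ s + dAt f x v • s x}
  add_mem' := by
    rintro δ δ' ⟨v, hv⟩ ⟨w, hw⟩
    refine ⟨v + w, fun f s => ?_⟩
    rw [LinearMap.add_apply, hv, hw, LinearMap.add_apply, map_add, smul_add, add_smul]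
    abel
  zero_mem' := ⟨0, fun f s => by simp⟩
  smul_mem' := by
    rintro c δ ⟨v, hv⟩
    refine ⟨c • v, fun f s => ?_⟩
    rw [LinearMap.smul_apply, hv, LinearMap.smul_apply, map_smul, smul_add, smul_assoc, smul_comm c]

variable [FiniteDimensional ℝ E] [IsManifold 𝓘(ℝ, E) ∞ M] [T2Space M]
  [ContMDiffVectorBundle ∞ ℝ L 𝓘(ℝ, E)]

variable (E L) in
/-- A cut-off local frame `e` of `L` near `x`, with the corresponding cut-off coordinate `c`. -/
theorem exists_frame (x : M) : ∃ (c : Cₛ^∞⟮𝓘(ℝ, E); ℝ, L⟯ →ₗ[C^∞⟮𝓘(ℝ, E), M; ℝ⟯] C^∞⟮𝓘(ℝ, E), M; ℝ⟯)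
    (e : Cₛ^∞⟮𝓘(ℝ, E); ℝ, L⟯) (χ : C^∞⟮𝓘(ℝ, E), M; ℝ⟯),
    (∀ᶠ y in 𝓝 x, χ y = 1) ∧ (∀ s, c s • e = χ • s) ∧ (∀ᶠ y in 𝓝 x, e y ≠ 0) ∧ ∀ w : L x, ∃ r : ℝ, w = r • e x := by
  let t := trivializationAt ℝ L x
  have hx : x ∈ t.baseSet := FiberBundle.mem_baseSet_trivializationAt ℝ L x
  let b : Module.Basis Unit ℝ ℝ := Module.Basis.singleton Unit ℝ
  obtain ⟨ψ, h1, h2⟩ := exists_bump (E := E) x (t.open_baseSet.mem_nhds hx)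
  let e : Cₛ^∞⟮𝓘(ℝ, E); ℝ, L⟯ := ⟨(ψ : M → ℝ) • t.localFrame b (),
    ContMDiffOn.smul_section_of_tsupport ψ.contMDiff.contMDiffOn t.open_baseSet h2
      (t.contMDiffOn_localFrame_baseSet (I := 𝓘(ℝ, E)) ∞ b ())⟩
  let c : Cₛ^∞⟮𝓘(ℝ, E); ℝ, L⟯ →ₗ[C^∞⟮𝓘(ℝ, E), M; ℝ⟯] C^∞⟮𝓘(ℝ, E), M; ℝ⟯ :=
    { toFun := fun s => ⟨fun y => ψ y • t.localFrameCoeff 𝓘(ℝ, E) b () y (s y), contMDiff_of_tsupport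
        fun y hy => ψ.contMDiff.contMDiffAt.smul (contMDiffAt_localFrameCoeff b
          (h2 (tsupport_smul_subset_left _ _ hy)) s.contMDiff.contMDiffAt ())⟩
      map_add' := fun s s' => by
        ext y
        change ψ y * _ = ψ y * _ + ψ y * _
        rw [← mul_add, ← map_add]; rfl
      map_smul' := fun f s => by
        ext y
        change ψ y * t.localFrameCoeff 𝓘(ℝ, E) b () y (f y • s y) = f y * (ψ y * _)
        rw [map_smul, smul_eq_mul]; ring }
  have hsum : ∀ y ∈ t.baseSet, ∀ w : L y, w = t.localFrameCoeff 𝓘(ℝ, E) b () y w • t.localFrame b () y := by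
    intro y hy w
    have hs : (FiberBundle.extend ℝ w : ∀ y, L y) y = w := by simp
    have := t.eq_sum_localFrameCoeff_smul (I := 𝓘(ℝ, E)) (b := b) (s := (FiberBundle.extend ℝ w : ∀ y, L y)) hy
    rw [hs] at this
    simpa using this
  have hex : e x = t.localFrame b () x := by
    change ψ x • t.localFrame b () x = _
    rw [h1.self_of_nhds, one_smul]
  refine ⟨c, e, ψ * ψ, ?_, fun s => ?_, ?_, fun w => ⟨_, (hsum x hx w).trans (by rw [hex])⟩⟩
  · filter_upwards [h1] with y hy
    simp [hy]
  · ext y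
    change (ψ y • t.localFrameCoeff 𝓘(ℝ, E) b () y (s y)) • (ψ y • t.localFrame b () y) = (ψ y * ψ y) • s y
    by_cases hy : y ∈ tsupport ψ
    · conv_rhs => rw [hsum y (h2 hy) (s y)]
      simp only [smul_smul, smul_eq_mul]
      congr 1; ring
    · simp [image_eq_zero_of_notMem_tsupport hy]
  · filter_upwards [h1, t.open_baseSet.mem_nhds hx] with y hy hyb
    change ψ y • t.localFrame b () y ≠ 0
    rw [hy, one_smul, t.localFrame_apply_of_mem_baseSet b hyb]
    exact (t.basisAt b hyb).ne_zero ()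

theorem exists_section (x : M) (w : L x) : ∃ s : Cₛ^∞⟮𝓘(ℝ, E); ℝ, L⟯, s x = w := by
  obtain ⟨c, e, χ, -, -, -, h⟩ := exists_frame E L x
  obtain ⟨r, hr⟩ := h w
  exact ⟨r • e, hr.symm⟩

theorem symbol_unique {x : M} {δ : Cₛ^∞⟮𝓘(ℝ, E); ℝ, L⟯ →ₗ[ℝ] L x} {v w : TangentSpace 𝓘(ℝ, E) x}
    (hv : ∀ (f : C^∞⟮𝓘(ℝ, E), M; ℝ⟯) s, δ (f • s) = f x • δ s + dAt f x v • s x)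
    (hw : ∀ (f : C^∞⟮𝓘(ℝ, E), M; ℝ⟯) s, δ (f • s) = f x • δ s + dAt f x w • s x) : v = w := by
  obtain ⟨c, e, χ, -, -, he, -⟩ := exists_frame E L x
  refine sub_eq_zero.1 (eq_zero_of_dAt _ fun f => ?_)
  have h := (hv f e).symm.trans (hw f e)
  have h2 := smul_left_injective ℝ he.self_of_nhds (add_left_cancel h)
  rw [map_sub]
  exact sub_eq_zero.2 h2

variable (E L) in
/-- The symbol `σ : der_x L → T_x M`. -/
def symbol (x : M) : derFiber E L x →ₗ[ℝ] TangentSpace 𝓘(ℝ, E) x where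
  toFun δ := δ.2.choose
  map_add' δ δ' := by
    refine symbol_unique (δ + δ').2.choose_spec fun f s => ?_
    have h1 := δ.2.choose_spec f s
    have h2 := δ'.2.choose_spec f s
    rw [Submodule.coe_add, LinearMap.add_apply, h1, h2, LinearMap.add_apply, map_add, smul_add, add_smul]
    abel
  map_smul' c δ := by
    refine symbol_unique (c • δ).2.choose_spec fun f s => ?_
    have h1 := δ.2.choose_spec f s
    rw [Submodule.coe_smul, LinearMap.smul_apply, h1, LinearMap.smul_apply, RingHom.id_apply, map_smul,
      smul_add, smul_assoc, smul_comm c]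

theorem der_smul {x : M} (δ : derFiber E L x) (f : C^∞⟮𝓘(ℝ, E), M; ℝ⟯) (s : Cₛ^∞⟮𝓘(ℝ, E); ℝ, L⟯) :
    δ.1 (f • s) = f x • δ.1 s + dAt f x (symbol E L x δ) • s x :=
  δ.2.choose_spec f s

theorem symbol_eq {x : M} (δ : derFiber E L x) (v : TangentSpace 𝓘(ℝ, E) x)
    (h : ∀ (f : C^∞⟮𝓘(ℝ, E), M; ℝ⟯) (s : Cₛ^∞⟮𝓘(ℝ, E); ℝ, L⟯), δ.1 (f • s) = f x • δ.1 s + dAt f x v • s x) :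
    symbol E L x δ = v := symbol_unique (der_smul δ) h

/-- A first order operator at `x` on a line bundle is a derivation at `x`. -/
theorem mem_derFiber_of_firstOrder {x : M} (δ : Cₛ^∞⟮𝓘(ℝ, E); ℝ, L⟯ →ₗ[ℝ] L x)
    (h : ∀ (f g : C^∞⟮𝓘(ℝ, E), M; ℝ⟯) s,
      δ (f • g • s) - f x • δ (g • s) - g x • δ (f • s) + (f x * g x) • δ s = 0) :
    δ ∈ derFiber E L x := by
  obtain ⟨c, e, χ, hχ, hce, he, hr⟩ := exists_frame E L x
  have hχx : χ x = 1 := hχ.self_of_nhds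
  have hP : ∀ (f g : C^∞⟮𝓘(ℝ, E), M; ℝ⟯) s,
      δ (f • g • s) = f x • δ (g • s) + g x • δ (f • s) - (f x * g x) • δ s := by
    intro f g s
    rw [← sub_eq_zero, ← h f g s]; abel
  let ev : ℝ →ₗ[ℝ] L x := LinearMap.toSpanSingleton ℝ (L x) (e x)
  have hev : Function.Bijective ev := ⟨fun a b hab => smul_left_injective ℝ he.self_of_nhds hab,
    fun w => by obtain ⟨r, rfl⟩ := hr w; exact ⟨r, rfl⟩⟩
  let ev' : ℝ ≃ₗ[ℝ] L x := LinearEquiv.ofBijective ev hev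
  let D : C^∞⟮𝓘(ℝ, E), M; ℝ⟯ →ₗ[ℝ] L x :=
    { toFun := fun f => δ (f • e) - f x • δ e
      map_add' := fun f g => by
        simp only [add_smul, map_add, ContMDiffMap.coe_add, Pi.add_apply]; abel
      map_smul' := fun a f => by
        simp only [smul_assoc, map_smul, ContMDiffMap.coe_smul, Pi.smul_apply, RingHom.id_apply, smul_sub] }
  have hDmul : ∀ f g, D (f * g) = f x • D g + g x • D f := by
    intro f g
    change δ ((f * g) • e) - (f x * g x) • δ e = f x • (δ (g • e) - g x • δ e) + g x • (δ (f • e) - f x • δ e)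
    rw [mul_smul, hP]
    module
  obtain ⟨v, hv⟩ := exists_vector_of_pointDerivation x (ev'.symm.toLinearMap ∘ₗ D) (fun f g => by
    simp [hDmul])
  have hv' : ∀ f, D f = dAt f x v • e x := fun f => by
    rw [← hv f]
    exact (ev'.apply_symm_apply (D f)).symm
  refine ⟨v, fun f s => ?_⟩
  have e1 : s = c s • e + (1 - χ) • s := by rw [hce, sub_smul, one_smul]; abel
  have h1 : δ (f • s) - f x • δ s = c s x • D f := by
    have h2 : δ (f • c s • e) - f x • δ (c s • e) = c s x • D f := by
      rw [hP]
      change _ = c s x • (δ (f • e) - f x • δ e)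
      module
    have h3 : δ (f • (1 - χ) • s) - f x • δ ((1 - χ) • s) = 0 := by
      rw [hP]
      simp [hχx]
    rw [← h2]
    conv_lhs => rw [e1]
    rw [smul_add, map_add, map_add, smul_add]
    rw [add_sub_add_comm, h3, add_zero]
  have h4 : s x = c s x • e x := by
    have := congrArg (fun s : Cₛ^∞⟮𝓘(ℝ, E); ℝ, L⟯ => s x) (hce s)
    simpa [hχx] using this.symm
  rw [← sub_eq_iff_eq_add', h1, hv', h4, smul_comm]

variable (E L) in
/-- Derivations `Δ` of the line bundle `L`, with their symbols `X` acting on functions. -/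
structure Der where
  op : Cₛ^∞⟮𝓘(ℝ, E); ℝ, L⟯ →ₗ[ℝ] Cₛ^∞⟮𝓘(ℝ, E); ℝ, L⟯
  X : C^∞⟮𝓘(ℝ, E), M; ℝ⟯ → C^∞⟮𝓘(ℝ, E), M; ℝ⟯
  op_smul : ∀ f s, op (f • s) = f • op s + X f • s

theorem Der.op_smul_apply (Δ : Der E L) (f s) (x : M) :
    Δ.op (f • s) x = f x • Δ.op s x + Δ.X f x • s x := by
  rw [Δ.op_smul]; rfl

/-- The value of a derivation at a point. -/
def Der.at (Δ : Der E L) (x : M) : derFiber E L x :=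
  ⟨evalAt E L x ∘ₗ Δ.op, mem_derFiber_of_firstOrder _ fun f g s => by
    simp only [LinearMap.comp_apply, evalAt_apply, Δ.op_smul_apply, smul_section_apply]
    module⟩

@[simp] theorem Der.at_apply (Δ : Der E L) (x : M) (s) : (Δ.at x).1 s = Δ.op s x := rfl

theorem Der.symbol_at (Δ : Der E L) (x : M) (f : C^∞⟮𝓘(ℝ, E), M; ℝ⟯) :
    dAt f x (symbol E L x (Δ.at x)) = Δ.X f x := by
  obtain ⟨c, e, χ, -, -, he, -⟩ := exists_frame E L x
  have h := der_smul (Δ.at x) f e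
  rw [Der.at_apply, Der.at_apply, Δ.op_smul_apply] at h
  exact (smul_left_injective ℝ he.self_of_nhds (add_left_cancel h)).symm

/-- The commutator of two derivations. -/
def Der.comm (Δ Δ' : Der E L) : Der E L where
  op := Δ.op ∘ₗ Δ'.op - Δ'.op ∘ₗ Δ.op
  X f := Δ.X (Δ'.X f) - Δ'.X (Δ.X f)
  op_smul f s := by
    simp only [LinearMap.sub_apply, LinearMap.comp_apply, Δ.op_smul, Δ'.op_smul, map_add, smul_sub, sub_smul]
    abel

/-- A smooth family of pointwise derivations is a derivation. -/
def Der.ofPointwise (δ : ∀ x, derFiber E L x)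
    (h : ∀ s : Cₛ^∞⟮𝓘(ℝ, E); ℝ, L⟯, ContMDiff 𝓘(ℝ, E) (𝓘(ℝ, E).prod 𝓘(ℝ, ℝ)) ∞
      (fun x => (TotalSpace.mk' ℝ x ((δ x).1 s) : TotalSpace ℝ L))) : Der E L :=
  let op : Cₛ^∞⟮𝓘(ℝ, E); ℝ, L⟯ →ₗ[ℝ] Cₛ^∞⟮𝓘(ℝ, E); ℝ, L⟯ :=
    { toFun := fun s => ⟨fun x => (δ x).1 s, h s⟩
      map_add' := fun s t => by ext x; exact map_add (δ x).1 s t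
      map_smul' := fun c s => by ext x; exact map_smul (δ x).1 c s }
  { op := op
    X := fun f => ⟨fun x => dAt f x (symbol E L x (δ x)), by
      intro x
      obtain ⟨c, e, χ, hχ, hce, he, -⟩ := exists_frame E L x
      refine (c (op (f • e) - f • op e)).contMDiff.contMDiffAt.congr_of_eventuallyEq ?_
      filter_upwards [hχ, he] with y hy hey
      have h1 := congrArg (fun s : Cₛ^∞⟮𝓘(ℝ, E); ℝ, L⟯ => s y) (hce (op (f • e) - f • op e))
      have h2 : c (op (f • e) - f • op e) y • e y = χ y • ((δ y).1 (f • e) - f y • (δ y).1 e) := h1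
      rw [der_smul, hy, one_smul, add_sub_cancel_left] at h2
      exact (smul_left_injective ℝ hey h2).symm⟩
    op_smul := fun f s => by ext x; exact der_smul (δ x) f s }

end LineBundle


section Jets

variable {E : Type*} [NormedAddCommGroup E] [NormedSpace ℝ E]
  {M : Type*} [TopologicalSpace M] [ChartedSpace E M]
  {L : M → Type*} [TopologicalSpace (TotalSpace ℝ L)] [∀ x, AddCommGroup (L x)]
  [∀ x, Module ℝ (L x)] [∀ x, TopologicalSpace (L x)] [FiberBundle ℝ L] [VectorBundle ℝ ℝ L]

variable (E L) in
/-- Sections of `L` whose first jet at `x` is zero: `𝔪_x² Γ(L)`. -/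
def zeroJets (x : M) : Submodule ℝ Cₛ^∞⟮𝓘(ℝ, E); ℝ, L⟯ :=
  ((vanishingIdeal x ^ 2 : Ideal C^∞⟮𝓘(ℝ, E), M; ℝ⟯) •
    (⊤ : Submodule C^∞⟮𝓘(ℝ, E), M; ℝ⟯ Cₛ^∞⟮𝓘(ℝ, E); ℝ, L⟯)).restrictScalars ℝ

variable (E L) in
/-- The fibre at `x` of the first jet bundle `J¹L`: the real vector space `Γ(L) / 𝔪_x² Γ(L)`. -/
def JetFiber (x : M) : Type _ := Cₛ^∞⟮𝓘(ℝ, E); ℝ, L⟯ ⧸ zeroJets E L x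

instance (x : M) : AddCommGroup (JetFiber E L x) :=
  inferInstanceAs (AddCommGroup (Cₛ^∞⟮𝓘(ℝ, E); ℝ, L⟯ ⧸ zeroJets E L x))

instance (x : M) : Module ℝ (JetFiber E L x) :=
  inferInstanceAs (Module ℝ (Cₛ^∞⟮𝓘(ℝ, E); ℝ, L⟯ ⧸ zeroJets E L x))

variable (E L) in
/-- The first jet `j¹_x λ` of a section at a point. -/
def jet (x : M) : Cₛ^∞⟮𝓘(ℝ, E); ℝ, L⟯ →ₗ[ℝ] JetFiber E L x := (zeroJets E L x).mkQ

theorem jet_surjective (x : M) : Function.Surjective (jet E L x) := Submodule.mkQ_surjective _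

theorem map_zeroJets {x : M} {N : Type*} [AddCommGroup N] [Module ℝ N]
    (δ : Cₛ^∞⟮𝓘(ℝ, E); ℝ, L⟯ →ₗ[ℝ] N)
    (h : ∀ (f g : C^∞⟮𝓘(ℝ, E), M; ℝ⟯) s, f x = 0 → g x = 0 → δ (f • g • s) = 0) :
    zeroJets E L x ≤ LinearMap.ker δ := by
  intro s hs
  rw [LinearMap.mem_ker]
  have hs' : s ∈ ((vanishingIdeal x ^ 2 : Ideal C^∞⟮𝓘(ℝ, E), M; ℝ⟯) •
    (⊤ : Submodule C^∞⟮𝓘(ℝ, E), M; ℝ⟯ Cₛ^∞⟮𝓘(ℝ, E); ℝ, L⟯)) := hs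
  refine Submodule.smul_induction_on hs' (fun f hf s _ => ?_) (fun s t h1 h2 => by rw [map_add, h1, h2, add_zero])
  rw [sq] at hf
  refine Submodule.mul_induction_on hf (fun a ha b hb => ?_) (fun a b h1 h2 => by rw [add_smul, map_add, h1, h2, add_zero])
  rw [mul_smul]
  exact h a b s ha hb

/-- Linear maps on `Γ(L)` that kill `𝔪_x² Γ(L)` are linear maps on `J¹_x L`. -/
def jetLift {x : M} {N : Type*} [AddCommGroup N] [Module ℝ N]
    (δ : Cₛ^∞⟮𝓘(ℝ, E); ℝ, L⟯ →ₗ[ℝ] N) (h : zeroJets E L x ≤ LinearMap.ker δ) : JetFiber E L x →ₗ[ℝ] N :=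
  (zeroJets E L x).liftQ δ h

@[simp] theorem jetLift_jet {x : M} {N : Type*} [AddCommGroup N] [Module ℝ N]
    (δ : Cₛ^∞⟮𝓘(ℝ, E); ℝ, L⟯ →ₗ[ℝ] N) (h : zeroJets E L x ≤ LinearMap.ker δ) (s) :
    jetLift δ h (jet E L x s) = δ s := rfl

theorem zeroJets_le_ker_der {x : M} (δ : derFiber E L x) : zeroJets E L x ≤ LinearMap.ker δ.1 := by
  refine map_zeroJets δ.1 fun f g s hf hg => ?_
  obtain ⟨v, hv⟩ := δ.2
  rw [hv, hf, smul_section_apply, hg]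
  simp

/-- The pairing `J¹_x L × der_x L → L_x`. -/
def jetPair {x : M} (a : JetFiber E L x) (δ : derFiber E L x) : L x :=
  jetLift δ.1 (zeroJets_le_ker_der δ) a

@[simp] theorem jetPair_jet {x : M} (s : Cₛ^∞⟮𝓘(ℝ, E); ℝ, L⟯) (δ : derFiber E L x) :
    jetPair (jet E L x s) δ = δ.1 s := rfl

theorem jetPair_add {x : M} (a b : JetFiber E L x) (δ : derFiber E L x) :
    jetPair (a + b) δ = jetPair a δ + jetPair b δ := map_add _ _ _

theorem jetPair_smul {x : M} (c : ℝ) (a : JetFiber E L x) (δ : derFiber E L x) :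
    jetPair (c • a) δ = c • jetPair a δ := map_smul _ _ _

theorem jetPair_sub {x : M} (a b : JetFiber E L x) (δ : derFiber E L x) :
    jetPair (a - b) δ = jetPair a δ - jetPair b δ := map_sub _ _ _

/-- Multiplication by a function, as an operator on `Γ(L)`. -/
def mulOp (a : C^∞⟮𝓘(ℝ, E), M; ℝ⟯) : Cₛ^∞⟮𝓘(ℝ, E); ℝ, L⟯ →ₗ[ℝ] Cₛ^∞⟮𝓘(ℝ, E); ℝ, L⟯ where
  toFun s := a • s
  map_add' := smul_add a
  map_smul' c s := smul_comm a c s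

/-- The commutator `[Δ, a]` of an operator with the multiplication by a function. -/
def opComm (Δ : Cₛ^∞⟮𝓘(ℝ, E); ℝ, L⟯ →ₗ[ℝ] Cₛ^∞⟮𝓘(ℝ, E); ℝ, L⟯) (a : C^∞⟮𝓘(ℝ, E), M; ℝ⟯) :
    Cₛ^∞⟮𝓘(ℝ, E); ℝ, L⟯ →ₗ[ℝ] Cₛ^∞⟮𝓘(ℝ, E); ℝ, L⟯ :=
  Δ ∘ₗ mulOp a - mulOp a ∘ₗ Δ

/-- Linear differential operators of order at most one. -/
def IsFirstOrder (Δ : Cₛ^∞⟮𝓘(ℝ, E); ℝ, L⟯ →ₗ[ℝ] Cₛ^∞⟮𝓘(ℝ, E); ℝ, L⟯) : Prop :=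
  ∀ a b : C^∞⟮𝓘(ℝ, E), M; ℝ⟯, opComm (opComm Δ a) b = 0

variable (E L) in
/-- An abstract Jacobi structure on `M` with Jacobi bundle `L`: a Lie bracket on `Γ(L)` which is a
first order differential operator in each entry. -/
structure JacobiStructure where
  /-- the Jacobi bracket -/
  bracket : Cₛ^∞⟮𝓘(ℝ, E); ℝ, L⟯ →ₗ[ℝ] Cₛ^∞⟮𝓘(ℝ, E); ℝ, L⟯ →ₗ[ℝ] Cₛ^∞⟮𝓘(ℝ, E); ℝ, L⟯
  bracket_self : ∀ s, bracket s s = 0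
  jacobi : ∀ s t u, bracket s (bracket t u) = bracket (bracket s t) u + bracket t (bracket s u)
  firstOrder_right : ∀ s, IsFirstOrder (bracket s)
  firstOrder_left : ∀ t, IsFirstOrder (bracket.flip t)

theorem IsFirstOrder.eq {Δ : Cₛ^∞⟮𝓘(ℝ, E); ℝ, L⟯ →ₗ[ℝ] Cₛ^∞⟮𝓘(ℝ, E); ℝ, L⟯} (h : IsFirstOrder Δ)
    (a b : C^∞⟮𝓘(ℝ, E), M; ℝ⟯) (s) (x : M) :
    Δ (a • b • s) x - a x • Δ (b • s) x - b x • Δ (a • s) x + (a x * b x) • Δ s x = 0 := by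
  have h1 := congrArg (fun t : Cₛ^∞⟮𝓘(ℝ, E); ℝ, L⟯ => t x) (LinearMap.congr_fun (h a b) s)
  have h2 : Δ (a • b • s) x - a x • Δ (b • s) x - b x • (Δ (a • s) x - a x • Δ s x) = 0 := h1
  rw [← h2]
  module

theorem IsFirstOrder.zeroJets_le {Δ : Cₛ^∞⟮𝓘(ℝ, E); ℝ, L⟯ →ₗ[ℝ] Cₛ^∞⟮𝓘(ℝ, E); ℝ, L⟯}
    (h : IsFirstOrder Δ) (x : M) : zeroJets E L x ≤ LinearMap.ker (evalAt E L x ∘ₗ Δ) := by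
  refine map_zeroJets _ fun f g s hf hg => ?_
  have := h.eq f g s x
  simpa [hf, hg] using this

theorem JacobiStructure.skew (J : JacobiStructure E L) (s t) : J.bracket s t = - J.bracket t s := by
  have h := J.bracket_self (s + t)
  simp only [map_add, LinearMap.add_apply, J.bracket_self, zero_add, add_zero] at h
  rw [← add_eq_zero_iff_eq_neg, add_comm]
  exact h

/-- The bilinear form `Λ̂_J : J¹_x L × J¹_x L → L_x`, with `Λ̂_J(j¹λ, j¹μ) = {λ, μ}(x)`. -/
def lambdaHat (J : JacobiStructure E L) (x : M) : JetFiber E L x →ₗ[ℝ] JetFiber E L x →ₗ[ℝ] L x :=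
  jetLift
    { toFun := fun s => jetLift (evalAt E L x ∘ₗ J.bracket s) ((J.firstOrder_right s).zeroJets_le x)
      map_add' := fun s t => by
        ext a
        obtain ⟨u, rfl⟩ := jet_surjective x a
        simp
      map_smul' := fun c s => by
        ext a
        obtain ⟨u, rfl⟩ := jet_surjective x a
        simp }
    (by
      intro s hs
      rw [LinearMap.mem_ker]
      ext a
      obtain ⟨u, rfl⟩ := jet_surjective x a
      exact (J.firstOrder_left u).zeroJets_le x hs)

@[simp] theorem lambdaHat_jet (J : JacobiStructure E L) (x : M) (s t) :
    lambdaHat J x (jet E L x s) (jet E L x t) = J.bracket s t x := rfl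

variable [FiniteDimensional ℝ E] [IsManifold 𝓘(ℝ, E) ∞ M] [T2Space M]
  [ContMDiffVectorBundle ∞ ℝ L 𝓘(ℝ, E)]

/-- The morphism `Λ̂_J^♯ : J¹_x L → der_x L`, with `Λ̂_J^♯(α) λ = Λ̂_J(α, j¹λ)`. -/
def sharpHat (J : JacobiStructure E L) (x : M) : JetFiber E L x →ₗ[ℝ] derFiber E L x :=
  LinearMap.codRestrict (derFiber E L x)
    { toFun := fun a => lambdaHat J x a ∘ₗ jet E L x
      map_add' := fun a b => by ext s; simp
      map_smul' := fun c a => by ext s; simp }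
    (by
      intro a
      obtain ⟨u, rfl⟩ := jet_surjective x a
      exact mem_derFiber_of_firstOrder _ fun f g s => (J.firstOrder_right u).eq f g s x)

@[simp] theorem sharpHat_apply (J : JacobiStructure E L) (x : M) (a : JetFiber E L x) (s) :
    (sharpHat J x a).1 s = lambdaHat J x a (jet E L x s) := rfl

/-- The Hamiltonian vector field `X_λ` at `x`: the symbol of `{λ, -}`. -/
def hamVec (J : JacobiStructure E L) (s : Cₛ^∞⟮𝓘(ℝ, E); ℝ, L⟯) (x : M) : TangentSpace 𝓘(ℝ, E) x :=
  symbol E L x (sharpHat J x (jet E L x s))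

theorem bracket_smul (J : JacobiStructure E L) (s t) (f : C^∞⟮𝓘(ℝ, E), M; ℝ⟯) (x : M) :
    J.bracket s (f • t) x = f x • J.bracket s t x + dAt f x (hamVec J s x) • t x :=
  der_smul (sharpHat J x (jet E L x s)) f t

theorem mem_zeroJets_of_fn {x : M} {f : C^∞⟮𝓘(ℝ, E), M; ℝ⟯} (hf : f ∈ vanishingIdeal x ^ 2)
    (s : Cₛ^∞⟮𝓘(ℝ, E); ℝ, L⟯) : f • s ∈ zeroJets E L x := by
  rw [zeroJets, Submodule.restrictScalars_mem]
  exact Submodule.smul_mem_smul hf Submodule.mem_top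

/-- A family of pointwise derivations that detects jets. -/
theorem jet_eq_zero_of_frame {x : M} {c : Cₛ^∞⟮𝓘(ℝ, E); ℝ, L⟯ →ₗ[C^∞⟮𝓘(ℝ, E), M; ℝ⟯] C^∞⟮𝓘(ℝ, E), M; ℝ⟯}
    {e : Cₛ^∞⟮𝓘(ℝ, E); ℝ, L⟯} {χ : C^∞⟮𝓘(ℝ, E), M; ℝ⟯}
    (hχ : ∀ᶠ y in 𝓝 x, χ y = 1) (hce : ∀ s, c s • e = χ • s) (s : Cₛ^∞⟮𝓘(ℝ, E); ℝ, L⟯)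
    (h0 : c s x = 0) (h1 : dAt (c s) x = 0) : jet E L x s = 0 := by
  have e1 : s = c s • e + (1 - χ) • s := by rw [hce, sub_smul, one_smul]; abel
  have : s ∈ zeroJets E L x := by
    rw [e1]
    refine add_mem (mem_zeroJets_of_fn (mem_sq_of_dAt_eq_zero h0 h1) e)
      (mem_zeroJets_of_fn (mem_sq_of_eventually_zero ?_) s)
    filter_upwards [hχ] with y hy
    simp [hy]
  exact (Submodule.Quotient.mk_eq_zero _).2 this

/-- Jets are separated by derivations. -/
theorem jetPair_ext_der {x : M} {a b : JetFiber E L x}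
    (h : ∀ Δ : Der E L, jetPair a (Δ.at x) = jetPair b (Δ.at x)) : a = b := by
  rw [← sub_eq_zero]
  have h' : ∀ Δ : Der E L, jetPair (a - b) (Δ.at x) = 0 := fun δ => by rw [jetPair_sub, h, sub_self]
  obtain ⟨s, hs⟩ := jet_surjective x (a - b)
  rw [← hs] at h' ⊢
  obtain ⟨c, e, χ, hχ, hce, he, hr⟩ := exists_frame E L x
  have hsx : s x = 0 := h' ⟨LinearMap.id, fun _ => 0, fun f s => by simp⟩
  have h0 : c s x = 0 := by
    have := congrArg (fun s : Cₛ^∞⟮𝓘(ℝ, E); ℝ, L⟯ => s x) (hce s)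
    simp only [smul_section_apply, hsx, smul_zero] at this
    exact (smul_eq_zero.1 this).resolve_right he.self_of_nhds
  refine jet_eq_zero_of_frame hχ hce s h0 ?_
  ext v
  obtain ⟨D, hD, hDx⟩ := exists_derivation x v
  have h1 := h' ⟨LinearMap.mk (AddHom.mk (fun s => D (c s) • e) fun s t => by
      rw [map_add, map_add, add_smul]) fun a s => by
      change D (c (a • s)) • e = a • D (c s) • e
      rw [LinearMap.map_smul_of_tower, map_smul, smul_assoc], fun f => χ * D f, fun f s => by
      change D (c (f • s)) • e = f • D (c s) • e + (χ * D f) • s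
      rw [map_smul, smul_eq_mul, hD, add_smul, mul_smul, mul_comm (c s), mul_smul, hce, smul_smul, smul_smul,
        mul_comm (D f)]⟩
  rw [jetPair_jet] at h1
  have h2 : D (c s) x • e x = 0 := h1
  rw [hDx] at h2
  exact (smul_eq_zero.1 h2).resolve_right he.self_of_nhds

theorem jetPair_ext {x : M} {a b : JetFiber E L x} (h : ∀ δ, jetPair a δ = jetPair b δ) : a = b :=
  jetPair_ext_der fun Δ => h (Δ.at x)

theorem jet_smul_eq {x : M} (f : C^∞⟮𝓘(ℝ, E), M; ℝ⟯) (s : Cₛ^∞⟮𝓘(ℝ, E); ℝ, L⟯) (δ : derFiber E L x) :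
    jetPair (jet E L x (f • s) - f x • jet E L x s) δ = dAt f x (symbol E L x δ) • s x := by
  rw [jetPair_sub, jetPair_smul, jetPair_jet, jetPair_jet, der_smul, add_sub_cancel_left]

variable (E L) in
theorem exists_cosymbol (x : M) (ξ : TangentSpace 𝓘(ℝ, E) x →L[ℝ] ℝ) (w : L x) :
    ∃ a : JetFiber E L x, ∃ (f : C^∞⟮𝓘(ℝ, E), M; ℝ⟯) (s : Cₛ^∞⟮𝓘(ℝ, E); ℝ, L⟯),
      dAt f x = ξ ∧ s x = w ∧ a = jet E L x (f • s) - f x • jet E L x s := by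
  obtain ⟨f, -, hf⟩ := exists_dAt_eq x ξ
  obtain ⟨s, hs⟩ := exists_section (E := E) x w
  exact ⟨_, f, s, hf, hs, rfl⟩

variable (E L) in
theorem cosymbol_pair (x : M) (ξ : TangentSpace 𝓘(ℝ, E) x →L[ℝ] ℝ) (w : L x) (δ : derFiber E L x) :
    jetPair (exists_cosymbol E L x ξ w).choose δ = ξ (symbol E L x δ) • w := by
  obtain ⟨f, s, h1, h2, h3⟩ := (exists_cosymbol E L x ξ w).choose_spec
  rw [h3, jet_smul_eq, h1, h2]

variable (E L) in
/-- The co-symbol `γ : T*_x M ⊗ L_x → J¹_x L`, `γ(d_x f ⊗ λ(x)) = [j¹, f] λ (x)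
= j¹_x(fλ) - f(x) j¹_x λ`, as a bilinear map. -/
def cosymbol (x : M) : (TangentSpace 𝓘(ℝ, E) x →L[ℝ] ℝ) →ₗ[ℝ] L x →ₗ[ℝ] JetFiber E L x :=
  LinearMap.mk₂ ℝ (fun ξ w => (exists_cosymbol E L x ξ w).choose)
    (fun ξ η w => jetPair_ext fun δ => by
      rw [jetPair_add, cosymbol_pair, cosymbol_pair, cosymbol_pair, ← add_smul]; rfl)
    (fun c ξ w => jetPair_ext fun δ => by
      rw [jetPair_smul, cosymbol_pair, cosymbol_pair, smul_smul]; rfl)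
    (fun ξ w w' => jetPair_ext fun δ => by
      rw [jetPair_add, cosymbol_pair, cosymbol_pair, cosymbol_pair, smul_add])
    (fun c ξ w => jetPair_ext fun δ => by
      rw [jetPair_smul, cosymbol_pair, cosymbol_pair, smul_comm])

theorem jetPair_cosymbol {x : M} (ξ : TangentSpace 𝓘(ℝ, E) x →L[ℝ] ℝ) (w : L x) (δ : derFiber E L x) :
    jetPair (cosymbol E L x ξ w) δ = ξ (symbol E L x δ) • w := cosymbol_pair E L x ξ w δ

theorem cosymbol_dAt (x : M) (f : C^∞⟮𝓘(ℝ, E), M; ℝ⟯) (s : Cₛ^∞⟮𝓘(ℝ, E); ℝ, L⟯) :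
    cosymbol E L x (dAt f x) (s x) = jet E L x (f • s) - f x • jet E L x s :=
  jetPair_ext fun δ => by rw [jetPair_cosymbol, jet_smul_eq]

/-- The bi-symbol `Λ_J(ξ ⊗ w, θ ⊗ u) = Λ̂_J(γ(ξ ⊗ w), γ(θ ⊗ u))`. -/
def biSymbol (J : JacobiStructure E L) (x : M) (ξ : TangentSpace 𝓘(ℝ, E) x →L[ℝ] ℝ) (w : L x)
    (θ : TangentSpace 𝓘(ℝ, E) x →L[ℝ] ℝ) (u : L x) : L x :=
  lambdaHat J x (cosymbol E L x ξ w) (cosymbol E L x θ u)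

/-- The morphism `Λ_J^♯ = σ ∘ Λ̂_J^♯ ∘ γ : T*_x M ⊗ L_x → T_x M`, as a bilinear map. -/
def sharp (J : JacobiStructure E L) (x : M) :
    (TangentSpace 𝓘(ℝ, E) x →L[ℝ] ℝ) →ₗ[ℝ] L x →ₗ[ℝ] TangentSpace 𝓘(ℝ, E) x :=
  (cosymbol E L x).compr₂ (symbol E L x ∘ₗ sharpHat J x)

/-- `⟨Λ_J^♯(ξ ⊗ w), θ⟩ u = Λ_J(ξ ⊗ w, θ ⊗ u)`, which determines `Λ_J^♯`. -/
theorem sharp_spec (J : JacobiStructure E L) (x : M) (ξ : TangentSpace 𝓘(ℝ, E) x →L[ℝ] ℝ) (w : L x)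
    (θ : TangentSpace 𝓘(ℝ, E) x →L[ℝ] ℝ) (u : L x) :
    θ (sharp J x ξ w) • u = biSymbol J x ξ w θ u := by
  have h : ∀ a b : JetFiber E L x, lambdaHat J x a b = jetPair b (sharpHat J x a) := by
    intro a b
    obtain ⟨t, rfl⟩ := jet_surjective x b
    rfl
  rw [biSymbol, h, jetPair_cosymbol]
  rfl

end Jets


section SmoothBundle

variable {M : Type*} (E : Type*) [NormedAddCommGroup E] [NormedSpace ℝ E]
  [TopologicalSpace M] [ChartedSpace E M] {A : M → Type*} [∀ x, AddCommGroup (A x)] [∀ x, Module ℝ (A x)]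

/-- `ΓA` is the space of smooth sections of a smooth vector bundle with fibres `A x`: it is a module over
the smooth functions, membership is local, and there are local frames. -/
structure IsVectorBundle (ΓA : Submodule ℝ (∀ x, A x)) : Prop where
  smul_mem : ∀ (f : C^∞⟮𝓘(ℝ, E), M; ℝ⟯) (α : ΓA), (fun x => f x • α.1 x) ∈ ΓA
  local_mem : ∀ α : ∀ x, A x, (∀ x, ∃ α' ∈ ΓA, ∀ᶠ y in 𝓝 x, α y = α' y) → α ∈ ΓA
  frame : ∀ x, ∃ (n : ℕ) (e : Fin n → ΓA),
    (∀ᶠ y in 𝓝 x, LinearIndependent ℝ (fun i => (e i).1 y) ∧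
      Submodule.span ℝ (Set.range fun i => (e i).1 y) = ⊤) ∧
    ∀ α : ΓA, ∃ c : Fin n → C^∞⟮𝓘(ℝ, E), M; ℝ⟯, ∀ᶠ y in 𝓝 x, α.1 y = ∑ i, c i y • (e i).1 y
end SmoothBundle

section AbstractAlgebroid

variable {M : Type*} (E : Type*) [NormedAddCommGroup E] [NormedSpace ℝ E] [FiniteDimensional ℝ E]
  [TopologicalSpace M] [ChartedSpace E M] [IsManifold 𝓘(ℝ, E) ∞ M] [T2Space M]
  (L : M → Type*) [TopologicalSpace (TotalSpace ℝ L)] [∀ x, AddCommGroup (L x)]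
  [∀ x, Module ℝ (L x)] [∀ x, TopologicalSpace (L x)] [FiberBundle ℝ L] [VectorBundle ℝ ℝ L]
  [ContMDiffVectorBundle ∞ ℝ L 𝓘(ℝ, E)]
  {A : M → Type*} [∀ x, AddCommGroup (A x)] [∀ x, Module ℝ (A x)]

/-- A Jacobi algebroid `(A, L)` over `M`, where the vector bundle `A` is given by its fibres `A x` and
its space `ΓA` of smooth sections: a Lie algebroid structure on `A`, and a flat `A`-connection `∇` in
the line bundle `L`. -/
structure JacobiAlgebroid (ΓA : Submodule ℝ (∀ x, A x)) where
  bundle : IsVectorBundle E ΓA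
  /-- the anchor -/
  anchor : ∀ x, A x →ₗ[ℝ] TangentSpace 𝓘(ℝ, E) x
  anchor_smooth : ∀ (α : ΓA) (f : C^∞⟮𝓘(ℝ, E), M; ℝ⟯),
    ContMDiff 𝓘(ℝ, E) 𝓘(ℝ, ℝ) ∞ fun x => dAt f x (anchor x (α.1 x))
  /-- the Lie bracket -/
  bracket : ΓA →ₗ[ℝ] ΓA →ₗ[ℝ] ΓA
  bracket_self : ∀ α, bracket α α = 0
  jacobi : ∀ α β γ, bracket α (bracket β γ) = bracket (bracket α β) γ + bracket β (bracket α γ)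
  leibniz : ∀ (α β : ΓA) (f : C^∞⟮𝓘(ℝ, E), M; ℝ⟯) (x : M), (bracket α ⟨_, bundle.smul_mem f β⟩).1 x =
    f x • (bracket α β).1 x + dAt f x (anchor x (α.1 x)) • β.1 x
  /-- the flat connection -/
  conn : ∀ x, A x →ₗ[ℝ] derFiber E L x
  conn_symbol : ∀ x a, symbol E L x (conn x a) = anchor x a
  conn_smooth : ∀ (α : ΓA) (s : Cₛ^∞⟮𝓘(ℝ, E); ℝ, L⟯), ContMDiff 𝓘(ℝ, E) (𝓘(ℝ, E).prod 𝓘(ℝ, ℝ)) ∞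
    fun x => (TotalSpace.mk' ℝ x ((conn x (α.1 x)).1 s) : TotalSpace ℝ L)
  flat : ∀ (α β : ΓA) (s : Cₛ^∞⟮𝓘(ℝ, E); ℝ, L⟯) (x : M), (conn x ((bracket α β).1 x)).1 s =
    (conn x (α.1 x)).1 ⟨_, conn_smooth β s⟩ - (conn x (β.1 x)).1 ⟨_, conn_smooth α s⟩

end AbstractAlgebroid

section JetAlgebroid

variable {E : Type*} [NormedAddCommGroup E] [NormedSpace ℝ E]
  {M : Type*} [TopologicalSpace M] [ChartedSpace E M]
  {L : M → Type*} [TopologicalSpace (TotalSpace ℝ L)] [∀ x, AddCommGroup (L x)]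
  [∀ x, Module ℝ (L x)] [∀ x, TopologicalSpace (L x)] [FiberBundle ℝ L] [VectorBundle ℝ ℝ L]

variable (E L) in
/-- The finite sums `∑ f_i j¹λ_i`. -/
def jetSpan : Submodule ℝ (∀ x, JetFiber E L x) :=
  Submodule.span ℝ {α | ∃ (f : C^∞⟮𝓘(ℝ, E), M; ℝ⟯) (s : Cₛ^∞⟮𝓘(ℝ, E); ℝ, L⟯),
    α = fun x => f x • jet E L x s}

variable (E L) in
/-- The smooth sections of `J¹L`: those locally of the form `∑ f_i j¹λ_i`. -/
def jetSections : Submodule ℝ (∀ x, JetFiber E L x) where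
  carrier := {α | ∀ x, ∃ α' ∈ jetSpan E L, ∀ᶠ y in 𝓝 x, α y = α' y}
  add_mem' := by
    intro α β hα hβ x
    obtain ⟨α', h1, h2⟩ := hα x
    obtain ⟨β', h3, h4⟩ := hβ x
    refine ⟨α' + β', add_mem h1 h3, ?_⟩
    filter_upwards [h2, h4] with y h h'
    simp [h, h']
  zero_mem' := fun x => ⟨0, zero_mem _, by simp⟩
  smul_mem' := by
    intro c α hα x
    obtain ⟨α', h1, h2⟩ := hα x
    refine ⟨c • α', Submodule.smul_mem _ c h1, ?_⟩
    filter_upwards [h2] with y h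
    simp [h]

theorem jetSpan_le : jetSpan E L ≤ jetSections E L := fun α hα _ =>
  ⟨α, hα, Filter.Eventually.of_forall fun _ => rfl⟩

theorem jetSpan_smul (f : C^∞⟮𝓘(ℝ, E), M; ℝ⟯) {α : ∀ x, JetFiber E L x} (h : α ∈ jetSpan E L) :
    (fun x => f x • α x) ∈ jetSpan E L := by
  induction h using Submodule.span_induction with
  | mem α hα =>
    obtain ⟨g, s, rfl⟩ := hα
    exact Submodule.subset_span ⟨f * g, s, funext fun x => by rw [smul_smul]; rfl⟩
  | zero =>
    convert zero_mem (jetSpan E L) using 1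
    funext x; simp
  | add α β _ _ h1 h2 =>
    convert add_mem h1 h2 using 1
    funext x; simp
  | smul c α _ h =>
    convert Submodule.smul_mem _ c h using 1
    funext x; simp [smul_comm c]

theorem jetSections_smul (f : C^∞⟮𝓘(ℝ, E), M; ℝ⟯) (α : jetSections E L) :
    (fun x => f x • α.1 x) ∈ jetSections E L := by
  intro x
  obtain ⟨α', h1, h2⟩ := α.2 x
  exact ⟨_, jetSpan_smul f h1, h2.mono fun y h => by simp [h]⟩

/-- The product of a function and a section of `J¹L`. -/
def fsmul (f : C^∞⟮𝓘(ℝ, E), M; ℝ⟯) (α : jetSections E L) : jetSections E L :=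
  ⟨fun x => f x • α.1 x, jetSections_smul f α⟩

@[simp] theorem fsmul_apply (f : C^∞⟮𝓘(ℝ, E), M; ℝ⟯) (α : jetSections E L) (x : M) :
    (fsmul f α).1 x = f x • α.1 x := rfl

variable (E L) in
/-- The first jet prolongation `j¹λ` of a section of `L`. -/
def jetProlong : Cₛ^∞⟮𝓘(ℝ, E); ℝ, L⟯ →ₗ[ℝ] jetSections E L where
  toFun s := ⟨fun x => jet E L x s, jetSpan_le (Submodule.subset_span ⟨1, s, funext fun x => by simp⟩)⟩
  map_add' s t := by ext x; exact map_add _ _ _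
  map_smul' c s := by ext x; exact map_smul _ _ _

@[simp] theorem jetProlong_apply (s : Cₛ^∞⟮𝓘(ℝ, E); ℝ, L⟯) (x : M) :
    (jetProlong E L s).1 x = jet E L x s := rfl

/-- Induction on finite sums `∑ f_i j¹λ_i`. -/
theorem jetSpan_induction {p : jetSections E L → Prop}
    (hmem : ∀ f s, p (fsmul f (jetProlong E L s)))
    (hadd : ∀ α β, p α → p β → p (α + β)) (hsmul : ∀ (c : ℝ) α, p α → p (c • α))
    (α : ∀ x, JetFiber E L x) (hα : α ∈ jetSpan E L) : p ⟨α, jetSpan_le hα⟩ := by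
  induction hα using Submodule.span_induction with
  | mem α hα =>
    obtain ⟨f, s, rfl⟩ := hα
    exact hmem f s
  | zero =>
    have h := hmem 0 0
    convert h using 1
    ext x; simp
  | add α β h1 h2 h3 h4 => exact hadd _ _ h3 h4
  | smul c α h1 h2 => exact hsmul c _ h2

theorem jets_smooth (φ : ∀ x, JetFiber E L x →ₗ[ℝ] L x)
    (h : ∀ s : Cₛ^∞⟮𝓘(ℝ, E); ℝ, L⟯, ContMDiff 𝓘(ℝ, E) (𝓘(ℝ, E).prod 𝓘(ℝ, ℝ)) ∞
      (fun x => (TotalSpace.mk' ℝ x (φ x (jet E L x s)) : TotalSpace ℝ L))) (α : jetSections E L) :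
    ContMDiff 𝓘(ℝ, E) (𝓘(ℝ, E).prod 𝓘(ℝ, ℝ)) ∞
      (fun x => (TotalSpace.mk' ℝ x (φ x (α.1 x)) : TotalSpace ℝ L)) := by
  intro x
  obtain ⟨α', h1, h2⟩ := α.2 x
  have key := jetSpan_induction (p := fun α : jetSections E L =>
    ContMDiff 𝓘(ℝ, E) (𝓘(ℝ, E).prod 𝓘(ℝ, ℝ)) ∞
      (fun x => (TotalSpace.mk' ℝ x (φ x (α.1 x)) : TotalSpace ℝ L))) ?_ ?_ ?_ α' h1
  · refine (key x).congr_of_eventuallyEq ?_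
    filter_upwards [h2] with y hy
    rw [hy]
  · intro f s
    refine (f.contMDiff.smul_section (h s)).congr fun y => ?_
    simp
  · intro α β h1 h2
    refine (h1.add_section h2).congr fun y => ?_
    simp
  · intro c α h
    refine (h.const_smul_section (a := c)).congr fun y => ?_
    simp

variable [FiniteDimensional ℝ E] [IsManifold 𝓘(ℝ, E) ∞ M] [T2Space M]
  [ContMDiffVectorBundle ∞ ℝ L 𝓘(ℝ, E)]

/-- A map on sections of `J¹L` that is linear over functions at `x` and kills jets is zero. -/
theorem tensorial_eq_zero {N : Type*} [AddCommGroup N] [Module ℝ N] (x : M) (Φ : jetSections E L → N)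
    (hadd : ∀ α β, Φ (α + β) = Φ α + Φ β)
    (hf : ∀ (f : C^∞⟮𝓘(ℝ, E), M; ℝ⟯) α, Φ (fsmul f α) = f x • Φ α)
    (hj : ∀ s, Φ (jetProlong E L s) = 0) (α : jetSections E L) : Φ α = 0 := by
  obtain ⟨α', h1, h2⟩ := α.2 x
  obtain ⟨χ, hχ, hχ'⟩ := exists_bump (E := E) x h2
  have h3 : Φ ⟨α', jetSpan_le h1⟩ = 0 := by
    refine jetSpan_induction (p := fun α => Φ α = 0) (fun f s => ?_) (fun α β h h' => ?_) (fun c α h => ?_) α' h1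
    · rw [hf, hj, smul_zero]
    · rw [hadd, h, h', add_zero]
    · have : c • α = fsmul (c • 1) α := by
        ext y; simp
      rw [this, hf, h, smul_zero]
  have h4 : fsmul χ α = fsmul χ ⟨α', jetSpan_le h1⟩ := by
    ext y
    by_cases hy : y ∈ tsupport χ
    · have : α.1 y = α' y := hχ' hy
      simp [this]
    · simp [image_eq_zero_of_notMem_tsupport hy]
  have h5 := congrArg Φ h4
  rw [hf, hf, hχ.self_of_nhds, h3] at h5
  simpa using h5

theorem Der.op_local (Δ : Der E L) {s t : Cₛ^∞⟮𝓘(ℝ, E); ℝ, L⟯} {x : M} (h : ∀ᶠ y in 𝓝 x, s y = t y) :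
    Δ.op s x = Δ.op t x := by
  obtain ⟨χ, hχ, hχ'⟩ := exists_bump (E := E) x h
  have h1 : χ • s = χ • t := by
    ext y
    by_cases hy : y ∈ tsupport χ
    · have : s y = t y := hχ' hy
      simp [this]
    · simp [image_eq_zero_of_notMem_tsupport hy]
  have h2 := congrArg (fun u : Cₛ^∞⟮𝓘(ℝ, E); ℝ, L⟯ => Δ.op u x) h1
  simp only [Δ.op_smul_apply, hχ.self_of_nhds, one_smul, h.self_of_nhds] at h2
  exact add_right_cancel h2

/-- The symbol of a derivation is determined by the derivation. -/
theorem Der.X_eq {Δ Δ' : Der E L} (h : Δ.op = Δ'.op) : Δ.X = Δ'.X := by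
  funext f
  ext x
  have : Δ.at x = Δ'.at x := Subtype.ext (by ext s; simp [h])
  rw [← Der.symbol_at, ← Der.symbol_at, this]

/-- The pairing of a section of `J¹L` with a derivation. -/
def pairS (α : jetSections E L) (Δ : Der E L) : Cₛ^∞⟮𝓘(ℝ, E); ℝ, L⟯ :=
  ⟨fun x => jetPair (α.1 x) (Δ.at x),
    jets_smooth (fun x => jetLift (Δ.at x).1 (zeroJets_le_ker_der _)) (fun s => (Δ.op s).contMDiff) α⟩

theorem pairS_apply (α : jetSections E L) (Δ : Der E L) (x : M) :
    pairS α Δ x = jetPair (α.1 x) (Δ.at x) := rfl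

theorem pairS_jet (s : Cₛ^∞⟮𝓘(ℝ, E); ℝ, L⟯) (Δ : Der E L) : pairS (jetProlong E L s) Δ = Δ.op s := rfl

theorem pairS_add (α β : jetSections E L) (Δ : Der E L) : pairS (α + β) Δ = pairS α Δ + pairS β Δ := by
  ext x; exact jetPair_add _ _ _

theorem pairS_sub (α β : jetSections E L) (Δ : Der E L) : pairS (α - β) Δ = pairS α Δ - pairS β Δ := by
  ext x; exact jetPair_sub _ _ _

theorem pairS_smul (c : ℝ) (α : jetSections E L) (Δ : Der E L) : pairS (c • α) Δ = c • pairS α Δ := by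
  ext x; exact jetPair_smul _ _ _

theorem pairS_fsmul (f : C^∞⟮𝓘(ℝ, E), M; ℝ⟯) (α : jetSections E L) (Δ : Der E L) :
    pairS (fsmul f α) Δ = f • pairS α Δ := by
  ext x; exact jetPair_smul _ _ _

theorem pairS_comb (α : jetSections E L) {Δ Δ₁ Δ₂ : Der E L} (f g : C^∞⟮𝓘(ℝ, E), M; ℝ⟯)
    (h : ∀ s, Δ.op s = f • Δ₁.op s + g • Δ₂.op s) : pairS α Δ = f • pairS α Δ₁ + g • pairS α Δ₂ := by
  ext x
  obtain ⟨s, hs⟩ := jet_surjective x (α.1 x)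
  change jetPair (α.1 x) (Δ.at x) = f x • jetPair (α.1 x) (Δ₁.at x) + g x • jetPair (α.1 x) (Δ₂.at x)
  rw [← hs]
  exact congrArg (fun u : Cₛ^∞⟮𝓘(ℝ, E); ℝ, L⟯ => u x) (h s)

theorem jetSections_ext {α β : jetSections E L} (h : ∀ Δ : Der E L, pairS α Δ = pairS β Δ) : α = β := by
  ext x
  exact jetPair_ext_der fun Δ => congrArg (fun u : Cₛ^∞⟮𝓘(ℝ, E); ℝ, L⟯ => u x) (h Δ)

theorem exists_local_inv {x : M} (d : C^∞⟮𝓘(ℝ, E), M; ℝ⟯) (hd : d x ≠ 0) :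
    ∃ h : C^∞⟮𝓘(ℝ, E), M; ℝ⟯, ∀ᶠ y in 𝓝 x, h y * d y = 1 := by
  have hU : ∀ᶠ y in 𝓝 x, d y ≠ 0 := d.contMDiff.continuous.continuousAt.eventually_ne hd
  obtain ⟨χ, h1, h2⟩ := exists_bump (E := E) x hU
  refine ⟨⟨fun y => χ y * (d y)⁻¹, contMDiff_of_tsupport fun y hy => ?_⟩, ?_⟩
  · have hy' : d y ≠ 0 := h2 (tsupport_mul_subset_left hy)
    exact χ.contMDiff.contMDiffAt.mul (d.contMDiff.contMDiffAt.inv₀ hy')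
  · filter_upwards [h1, hU] with y hy hy'
    change χ y * (d y)⁻¹ * d y = 1
    rw [hy, one_mul, inv_mul_cancel₀ hy']

theorem finrank_jetFiber_le {x : M} {c : Cₛ^∞⟮𝓘(ℝ, E); ℝ, L⟯ →ₗ[C^∞⟮𝓘(ℝ, E), M; ℝ⟯] C^∞⟮𝓘(ℝ, E), M; ℝ⟯}
    {e : Cₛ^∞⟮𝓘(ℝ, E); ℝ, L⟯} {χ : C^∞⟮𝓘(ℝ, E), M; ℝ⟯}
    (hχ : ∀ᶠ y in 𝓝 x, χ y = 1) (hce : ∀ s, c s • e = χ • s) :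
    FiniteDimensional ℝ (JetFiber E L x) ∧ Module.finrank ℝ (JetFiber E L x) ≤ Module.finrank ℝ E + 1 := by
  let Ψ : Cₛ^∞⟮𝓘(ℝ, E); ℝ, L⟯ →ₗ[ℝ] ℝ × (E →L[ℝ] ℝ) :=
    { toFun := fun s => (c s x, dAt (c s) x)
      map_add' := fun s t => by
        rw [map_add, dAt_add]; rfl
      map_smul' := fun r s => by
        rw [LinearMap.map_smul_of_tower, dAt_smul]; rfl }
  have hk : LinearMap.ker Ψ ≤ LinearMap.ker (jet E L x) := by
    intro s hs
    have hs' : Ψ s = 0 := hs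
    exact jet_eq_zero_of_frame hχ hce s (congrArg Prod.fst hs') (congrArg Prod.snd hs')
  let q : (Cₛ^∞⟮𝓘(ℝ, E); ℝ, L⟯ ⧸ LinearMap.ker Ψ) →ₗ[ℝ] JetFiber E L x := (LinearMap.ker Ψ).liftQ (jet E L x) hk
  have hq : Function.Surjective q := fun a => by
    obtain ⟨s, rfl⟩ := jet_surjective x a
    exact ⟨Submodule.Quotient.mk s, rfl⟩
  have i1 : FiniteDimensional ℝ (E →L[ℝ] ℝ) := inferInstance
  have i2 : FiniteDimensional ℝ (Cₛ^∞⟮𝓘(ℝ, E); ℝ, L⟯ ⧸ LinearMap.ker Ψ) :=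
    Module.Finite.equiv Ψ.quotKerEquivRange.symm
  refine ⟨Module.Finite.of_surjective q hq, (LinearMap.finrank_le_finrank_of_surjective hq).trans ?_⟩
  rw [Ψ.quotKerEquivRange.finrank_eq]
  refine (Submodule.finrank_le _).trans ?_
  rw [Module.finrank_prod, Module.finrank_self, add_comm]
  refine Nat.add_le_add_right (le_of_eq ?_) 1
  rw [← (LinearMap.toContinuousLinearMap : (E →ₗ[ℝ] ℝ) ≃ₗ[ℝ] (E →L[ℝ] ℝ)).finrank_eq]
  exact Subspace.dual_finrank_eq

/-- Local frames of `J¹L`. -/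
theorem jet_frame (x : M) : ∃ (n : ℕ) (e : Fin n → jetSections E L),
    (∀ᶠ y in 𝓝 x, LinearIndependent ℝ (fun i => (e i).1 y) ∧
      Submodule.span ℝ (Set.range fun i => (e i).1 y) = ⊤) ∧
    ∀ α : jetSections E L, ∃ c : Fin n → C^∞⟮𝓘(ℝ, E), M; ℝ⟯, ∀ᶠ y in 𝓝 x, α.1 y = ∑ i, c i y • (e i).1 y := by
  obtain ⟨c, e, χ, hχ, hce, he, hr⟩ := exists_frame E L x
  let n := Module.finrank ℝ E
  let b := Module.finBasis ℝ E
  choose D hD hDx using fun i : Fin n => exists_derivation (E := E) x (b i)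
  choose g hg0 hg using fun i : Fin n => exists_dAt_eq (E := E) x ((b.coord i).toContinuousLinearMap)
  let Δ : Option (Fin n) → Der E L := fun o => o.elim
    ⟨LinearMap.id, fun _ => 0, fun f s => by simp⟩
    fun i => ⟨LinearMap.mk (AddHom.mk (fun s => D i (c s) • e) fun s t => by
      rw [map_add, map_add, add_smul]) fun a s => by
      change D i (c (a • s)) • e = a • D i (c s) • e
      rw [LinearMap.map_smul_of_tower, map_smul, smul_assoc], fun f => χ * D i f, fun f s => by
      change D i (c (f • s)) • e = f • D i (c s) • e + (χ * D i f) • s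
      rw [map_smul, smul_eq_mul, hD, add_smul, mul_smul, mul_comm (c s), mul_smul, hce, smul_smul, smul_smul,
        mul_comm (D i f)]⟩
  let ε : Option (Fin n) → jetSections E L := fun o => o.elim (jetProlong E L e)
    fun i => jetProlong E L (g i • e) - fsmul (g i) (jetProlong E L e)
  have hcs : ∀ y, χ y = 1 → ∀ s, s y = c s y • e y := fun y hy s => by
    have := congrArg (fun s : Cₛ^∞⟮𝓘(ℝ, E); ℝ, L⟯ => s y) (hce s)
    simp only [smul_section_apply, hy, one_smul] at this
    exact this.symm
  let G : Matrix (Option (Fin n)) (Option (Fin n)) C^∞⟮𝓘(ℝ, E), M; ℝ⟯ := fun k l => c (pairS (ε k) (Δ l))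
  let Gy : M → Matrix (Option (Fin n)) (Option (Fin n)) ℝ := fun y k l => G k l y
  have hdet : ∀ y, G.det y = (Gy y).det := fun y =>
    RingHom.map_det (ContMDiffMap.evalRingHom (I := 𝓘(ℝ, E)) (I' := 𝓘(ℝ, ℝ)) (n := ∞) (R := ℝ) y) G
  have hadj : ∀ y k l, G.adjugate k l y = (Gy y).adjugate k l := fun y k l =>
    congrFun (congrFun (RingHom.map_adjugate
      (ContMDiffMap.evalRingHom (I := 𝓘(ℝ, E)) (I' := 𝓘(ℝ, ℝ)) (n := ∞) (R := ℝ) y) G) k) l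
  have hone : ∀ᶠ y in 𝓝 x, c e y = 1 := by
    filter_upwards [hχ, he] with y hy hey
    have h := hcs y hy e
    exact (smul_left_injective ℝ hey ((one_smul ℝ (e y)).trans h)).symm
  have hG : Gy x = 1 := by
    have hinj : ∀ s r, s x = r • e x → c s x = r := fun s r h =>
      smul_left_injective ℝ he.self_of_nhds ((hcs x hχ.self_of_nhds s).symm.trans h)
    ext k l
    refine hinj _ _ ?_
    rcases k with _ | k <;> rcases l with _ | l
    · change e x = (1 : ℝ) • e x
      rw [one_smul]
    · change D l (c e) x • e x = (0 : ℝ) • e x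
      have h1 : dAt (c e) x = dAt (1 : C^∞⟮𝓘(ℝ, E), M; ℝ⟯) x := dAt_congr hone
      have h2 : dAt (1 : C^∞⟮𝓘(ℝ, E), M; ℝ⟯) x = 0 := mfderiv_const
      rw [hDx, h1, h2]
      rfl
    · change pairS (jetProlong E L (g k • e) - fsmul (g k) (jetProlong E L e)) (Δ none) x = (0 : ℝ) • e x
      rw [pairS_sub, pairS_fsmul, pairS_jet, pairS_jet, zero_smul]
      change g k x • e x - g k x • e x = 0
      exact sub_self _
    · change pairS (jetProlong E L (g k • e) - fsmul (g k) (jetProlong E L e)) (Δ (some l)) x = _ • e x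
      rw [pairS_sub, pairS_fsmul, pairS_jet, pairS_jet, Der.op_smul, add_sub_cancel_left]
      change (χ x * D l (g k) x) • e x = _
      rw [hχ.self_of_nhds, one_mul, hDx, hg]
      congr 1
      change b.coord k (b l) = _
      rw [Module.Basis.coord_apply, Module.Basis.repr_self, Finsupp.single_apply, Matrix.one_apply]
      simp [eq_comm]
  have hdx : G.det x ≠ 0 := by rw [hdet, hG]; simp
  obtain ⟨h, hh⟩ := exists_local_inv G.det hdx
  have hpair : ∀ y, χ y = 1 → ∀ (α : jetSections E L) l,
      jetPair (α.1 y) ((Δ l).at y) = c (pairS α (Δ l)) y • e y := fun y hy α l => hcs y hy (pairS α (Δ l))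
  have hsum : ∀ y (r : Option (Fin n) → ℝ) (δ : derFiber E L y),
      jetPair (∑ k, r k • (ε k).1 y) δ = ∑ k, r k • jetPair ((ε k).1 y) δ := fun y r δ => by
    change jetLift δ.1 _ _ = _
    rw [map_sum]
    exact Finset.sum_congr rfl fun k _ => map_smul _ _ _
  have hvec : ∀ y, χ y = 1 → e y ≠ 0 → ∀ (r : Option (Fin n) → ℝ) (α : jetSections E L),
      α.1 y = ∑ k, r k • (ε k).1 y → (fun l => c (pairS α (Δ l)) y) = Matrix.vecMul r (Gy y) := by
    intro y hy hey r α hα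
    funext l
    refine smul_left_injective ℝ hey ?_
    change c (pairS α (Δ l)) y • e y = (∑ k, r k * Gy y k l) • e y
    rw [← hpair y hy, hα, hsum, Finset.sum_smul]
    refine Finset.sum_congr rfl fun k _ => ?_
    rw [hpair y hy, mul_smul]
  have hbasis : ∀ᶠ y in 𝓝 x, LinearIndependent ℝ (fun k => (ε k).1 y) ∧
      Submodule.span ℝ (Set.range fun k => (ε k).1 y) = ⊤ := by
    filter_upwards [hχ.eventually_nhds, he, hh] with y hy hey hdy
    have hy1 : χ y = 1 := hy.self_of_nhds
    have hdy' : (Gy y).det ≠ 0 := by rw [← hdet]; exact right_ne_zero_of_mul_eq_one hdy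
    have hli : LinearIndependent ℝ (fun k => (ε k).1 y) := by
      rw [Fintype.linearIndependent_iff]
      intro r hr0
      have h1 := hvec y hy1 hey r 0 hr0.symm
      have h2 : (fun l => c (pairS (0 : jetSections E L) (Δ l)) y) = 0 := by
        funext l
        have : pairS (0 : jetSections E L) (Δ l) = 0 := by
          have := pairS_sub (0 : jetSections E L) 0 (Δ l)
          simpa using this
        rw [this, map_zero]; rfl
      exact fun k => congrFun (Matrix.eq_zero_of_vecMul_eq_zero hdy' (h1.symm.trans h2)) k
    refine ⟨hli, ?_⟩
    obtain ⟨i1, i2⟩ := finrank_jetFiber_le hy hce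
    refine hli.span_eq_top_of_card_eq_finrank' (le_antisymm hli.fintype_card_le_finrank (i2.trans ?_))
    simp [n]
  let q := Fintype.equivFin (Option (Fin n))
  refine ⟨_, ε ∘ q.symm, ?_, fun α => ?_⟩
  · filter_upwards [hbasis] with y hy
    refine ⟨hy.1.comp _ q.symm.injective, ?_⟩
    rw [← hy.2]
    congr 1
    exact q.symm.surjective.range_comp (fun k => (ε k).1 y)
  · refine ⟨fun i => h * (Matrix.vecMul (fun l => c (pairS α (Δ l))) G.adjugate) (q.symm i), ?_⟩
    filter_upwards [hχ, he, hh, hbasis] with y hy hey hdy hby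
    have h1 : α.1 y ∈ Submodule.span ℝ (Set.range fun k => (ε k).1 y) := by rw [hby.2]; trivial
    obtain ⟨r, hr⟩ := (Submodule.mem_span_range_iff_exists_fun ℝ).1 h1
    have h2 := hvec y hy hey r α hr.symm
    have h3 : ∀ k, (h * (Matrix.vecMul (fun l => c (pairS α (Δ l))) G.adjugate) k) y = r k := by
      intro k
      have h4 : (Matrix.vecMul (fun l => c (pairS α (Δ l))) G.adjugate k) y =
          Matrix.vecMul (fun l => c (pairS α (Δ l)) y) (Gy y).adjugate k := by
        refine (map_sum (ContMDiffMap.evalRingHom (I := 𝓘(ℝ, E)) (I' := 𝓘(ℝ, ℝ)) (n := ∞) (R := ℝ) y)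
          (fun l => c (pairS α (Δ l)) * G.adjugate l k) Finset.univ).trans ?_
        change _ = ∑ l, c (pairS α (Δ l)) y * (Gy y).adjugate l k
        refine Finset.sum_congr rfl fun l _ => ?_
        change _ * G.adjugate l k y = _
        rw [hadj]
      change h y * _ = _
      rw [h4, h2, Matrix.vecMul_vecMul, Matrix.mul_adjugate, Matrix.vecMul_smul, Matrix.vecMul_one, ← hdet,
        Pi.smul_apply, smul_eq_mul, ← mul_assoc, hdy, one_mul]
    rw [← hr, ← q.symm.sum_comp (fun k => r k • (ε k).1 y)]
    exact Finset.sum_congr rfl fun i _ => by rw [h3]; rfl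

theorem jetSections_isVectorBundle : IsVectorBundle E (jetSections E L) where
  smul_mem := jetSections_smul
  local_mem α h x := by
    obtain ⟨α', h1, h2⟩ := h x
    obtain ⟨α'', h3, h4⟩ := h1 x
    refine ⟨α'', h3, ?_⟩
    filter_upwards [h2, h4] with y h h'
    rw [h, h']
  frame := jet_frame

theorem exists_lie (Δ : Der E L) (α : jetSections E L) : ∃ η : jetSections E L, ∀ D : Der E L,
    pairS η D = Δ.op (pairS α D) - pairS α (Δ.comm D) := by
  have h1 : ∀ (α' : ∀ x, JetFiber E L x) (hα' : α' ∈ jetSpan E L), ∃ η : jetSections E L, ∀ D : Der E L,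
      pairS η D = Δ.op (pairS ⟨α', jetSpan_le hα'⟩ D) - pairS ⟨α', jetSpan_le hα'⟩ (Δ.comm D) := by
    refine jetSpan_induction (p := fun α => ∃ η : jetSections E L, ∀ D : Der E L,
      pairS η D = Δ.op (pairS α D) - pairS α (Δ.comm D)) ?_ ?_ ?_
    · intro f s
      refine ⟨fsmul f (jetProlong E L (Δ.op s)) + fsmul (Δ.X f) (jetProlong E L s), fun D => ?_⟩
      simp only [pairS_add, pairS_fsmul, pairS_jet, Δ.op_smul, Der.comm, LinearMap.sub_apply,
        LinearMap.comp_apply, smul_sub]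
      abel
    · rintro α β ⟨η, h⟩ ⟨η', h'⟩
      refine ⟨η + η', fun D => ?_⟩
      simp only [pairS_add, map_add, h, h']
      abel
    · rintro c α ⟨η, h⟩
      refine ⟨c • η, fun D => ?_⟩
      simp only [pairS_smul, map_smul, h, smul_sub]
  choose α' hα' he using α.2
  choose η hη using fun x => h1 (α' x) (hα' x)
  have key : ∀ x, ∀ᶠ y in 𝓝 x, ∀ D, jetPair ((η x).1 y) (D.at y) =
      (Δ.op (pairS α D) - pairS α (Δ.comm D)) y := by
    intro x
    filter_upwards [eventually_eventually_nhds.2 (he x)] with y hy D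
    rw [← pairS_apply, hη]
    have e : ∀ D : Der E L, ∀ᶠ z in 𝓝 y, pairS ⟨α' x, jetSpan_le (hα' x)⟩ D z = pairS α D z :=
      fun D => hy.mono fun z hz => by rw [pairS_apply, pairS_apply, hz]
    change Δ.op _ y - _ = Δ.op _ y - _
    rw [Δ.op_local (e D), (e (Δ.comm D)).self_of_nhds]
  refine ⟨⟨fun x => (η x).1 x, fun x => ?_⟩, fun D => ?_⟩
  · obtain ⟨β, hβ, h2⟩ := (η x).2 x
    refine ⟨β, hβ, ?_⟩
    filter_upwards [h2, key x] with y hy hy'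
    rw [← hy]
    exact jetPair_ext_der fun D => by rw [hy', (key y).self_of_nhds]
  · ext x
    exact (key x).self_of_nhds D

/-- The Lie derivative of sections of `J¹L` along a derivation, with `𝓛_Δ j¹λ = j¹(Δ λ)`. -/
def lie (Δ : Der E L) (α : jetSections E L) : jetSections E L := (exists_lie Δ α).choose

theorem pairS_lie (Δ : Der E L) (α : jetSections E L) (D : Der E L) :
    pairS (lie Δ α) D = Δ.op (pairS α D) - pairS α (Δ.comm D) := (exists_lie Δ α).choose_spec D

theorem lie_jet (Δ : Der E L) (s) : lie Δ (jetProlong E L s) = jetProlong E L (Δ.op s) :=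
  jetSections_ext fun D => by
    simp only [pairS_lie, pairS_jet, Der.comm, LinearMap.sub_apply, LinearMap.comp_apply, sub_sub_cancel]

theorem lie_add (Δ : Der E L) (α β) : lie Δ (α + β) = lie Δ α + lie Δ β :=
  jetSections_ext fun D => by
    simp only [pairS_lie, pairS_add, map_add]; abel

theorem lie_smul (Δ : Der E L) (c : ℝ) (α) : lie Δ (c • α) = c • lie Δ α :=
  jetSections_ext fun D => by
    simp only [pairS_lie, pairS_smul, map_smul, smul_sub]

theorem lie_fsmul (Δ : Der E L) (f : C^∞⟮𝓘(ℝ, E), M; ℝ⟯) (α) :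
    lie Δ (fsmul f α) = fsmul f (lie Δ α) + fsmul (Δ.X f) α :=
  jetSections_ext fun D => by
    simp only [pairS_lie, pairS_fsmul, pairS_add, Δ.op_smul, smul_sub]; abel

theorem lie_comb {Δ Δ₁ Δ₂ : Der E L} (c d : ℝ) (h : ∀ s, Δ.op s = c • Δ₁.op s + d • Δ₂.op s) (α) :
    lie Δ α = c • lie Δ₁ α + d • lie Δ₂ α :=
  jetSections_ext fun D => by
    have e1 : ∀ (c : ℝ) (s : Cₛ^∞⟮𝓘(ℝ, E); ℝ, L⟯), (c • (1 : C^∞⟮𝓘(ℝ, E), M; ℝ⟯)) • s = c • s := by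
      intro c s; rw [smul_assoc, one_smul]
    rw [pairS_lie, pairS_add, pairS_smul, pairS_smul, pairS_lie, pairS_lie, h,
      pairS_comb α (Δ := Δ.comm D) (Δ₁ := Δ₁.comm D) (Δ₂ := Δ₂.comm D) (c • 1) (d • 1), e1, e1, smul_sub, smul_sub]
    · abel
    · intro s
      simp only [Der.comm, LinearMap.sub_apply, LinearMap.comp_apply, h, e1, map_add, map_smul, smul_sub]
      abel

/-- The behaviour of the Lie derivative under `Δ ↦ f Δ`. -/
theorem lie_fcomb {Δ Δ' : Der E L} (f : C^∞⟮𝓘(ℝ, E), M; ℝ⟯) (h : ∀ s, Δ'.op s = f • Δ.op s) (α) :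
    lie Δ' α = fsmul f (lie Δ α) + (jetProlong E L (f • pairS α Δ) - fsmul f (jetProlong E L (pairS α Δ))) :=
  jetSections_ext fun D => by
    rw [pairS_lie, h, pairS_comb α (Δ := Δ'.comm D) (Δ₁ := Δ.comm D) (Δ₂ := Δ) f (- D.X f)]
    · simp only [pairS_add, pairS_sub, pairS_fsmul, pairS_lie, pairS_jet, D.op_smul, smul_sub, neg_smul]
      abel
    · intro s
      simp only [Der.comm, LinearMap.sub_apply, LinearMap.comp_apply, h, D.op_smul, smul_sub, neg_smul]
      abel

/-- The derivation `∇_α = Λ̂_J^♯ ∘ α`. -/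
def nabla (J : JacobiStructure E L) (α : jetSections E L) : Der E L :=
  Der.ofPointwise (fun x => sharpHat J x (α.1 x)) fun s =>
    jets_smooth (fun x => (lambdaHat J x).flip (jet E L x s)) (fun t => (J.bracket t s).contMDiff) α

theorem nabla_at (J : JacobiStructure E L) (α : jetSections E L) (x : M) :
    (nabla J α).at x = sharpHat J x (α.1 x) := rfl

theorem nabla_apply (J : JacobiStructure E L) (α : jetSections E L) (s) (x : M) :
    (nabla J α).op s x = (sharpHat J x (α.1 x)).1 s := rfl

theorem nabla_X (J : JacobiStructure E L) (α : jetSections E L) (f : C^∞⟮𝓘(ℝ, E), M; ℝ⟯) (x : M) :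
    (nabla J α).X f x = dAt f x (symbol E L x (sharpHat J x (α.1 x))) := rfl

theorem nabla_jet (J : JacobiStructure E L) (s t) : (nabla J (jetProlong E L s)).op t = J.bracket s t := rfl

theorem nabla_add (J : JacobiStructure E L) (α β s) :
    (nabla J (α + β)).op s = (nabla J α).op s + (nabla J β).op s := by
  ext x
  change (sharpHat J x (α.1 x + β.1 x)).1 s = _
  rw [map_add]; rfl

theorem nabla_smul (J : JacobiStructure E L) (c : ℝ) (α s) :
    (nabla J (c • α)).op s = c • (nabla J α).op s := by
  ext x
  change (sharpHat J x (c • α.1 x)).1 s = _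
  rw [map_smul]; rfl

theorem nabla_fsmul (J : JacobiStructure E L) (f : C^∞⟮𝓘(ℝ, E), M; ℝ⟯) (α s) :
    (nabla J (fsmul f α)).op s = f • (nabla J α).op s := by
  ext x
  change (sharpHat J x (f x • α.1 x)).1 s = _
  rw [map_smul]; rfl

theorem lambdaHat_skew (J : JacobiStructure E L) (x : M) (a b : JetFiber E L x) :
    lambdaHat J x a b = - lambdaHat J x b a := by
  obtain ⟨s, rfl⟩ := jet_surjective x a
  obtain ⟨t, rfl⟩ := jet_surjective x b
  rw [lambdaHat_jet, J.skew]; rfl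

theorem jetPair_sharpHat (J : JacobiStructure E L) (x : M) (a b : JetFiber E L x) :
    jetPair b (sharpHat J x a) = lambdaHat J x a b := by
  obtain ⟨t, rfl⟩ := jet_surjective x b
  rfl

theorem pairS_nabla_skew (J : JacobiStructure E L) (α β : jetSections E L) :
    pairS β (nabla J α) = - pairS α (nabla J β) := by
  ext x
  change jetPair _ (sharpHat J x _) = - jetPair _ (sharpHat J x _)
  rw [jetPair_sharpHat, jetPair_sharpHat, lambdaHat_skew]

theorem nabla_comb (J : JacobiStructure E L) (c : ℝ) (α β s) :
    (nabla J (c • α + β)).op s = c • (nabla J α).op s + (1 : ℝ) • (nabla J β).op s := by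
  rw [nabla_add, nabla_smul, one_smul]

/-- `[α, β] = 𝓛_{∇_α} β - 𝓛_{∇_β} α - j¹ Λ̂_J(α, β)`. -/
def brFun (J : JacobiStructure E L) (α β : jetSections E L) : jetSections E L :=
  lie (nabla J α) β - lie (nabla J β) α - jetProlong E L (pairS β (nabla J α))

theorem brFun_skew (J : JacobiStructure E L) (α β : jetSections E L) : brFun J α β = - brFun J β α := by
  rw [brFun, brFun, pairS_nabla_skew J α β, map_neg]; abel

theorem brFun_add (J : JacobiStructure E L) (α β γ : jetSections E L) :
    brFun J α (β + γ) = brFun J α β + brFun J α γ := by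
  have h := lie_comb (Δ := nabla J (β + γ)) (Δ₁ := nabla J β) (Δ₂ := nabla J γ) 1 1
    (fun s => by rw [nabla_add, one_smul, one_smul]) α
  rw [brFun, brFun, brFun, lie_add, h, pairS_add, map_add, one_smul, one_smul]
  abel

theorem brFun_smul (J : JacobiStructure E L) (c : ℝ) (α β : jetSections E L) :
    brFun J α (c • β) = c • brFun J α β := by
  have h := lie_comb (Δ := nabla J (c • β)) (Δ₁ := nabla J β) (Δ₂ := nabla J β) c 0
    (fun s => by rw [nabla_smul, zero_smul, add_zero]) α
  rw [brFun, brFun, lie_smul, h, pairS_smul, map_smul, zero_smul, add_zero, smul_sub, smul_sub]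

theorem brFun_fsmul (J : JacobiStructure E L) (f : C^∞⟮𝓘(ℝ, E), M; ℝ⟯) (α β : jetSections E L) :
    brFun J α (fsmul f β) = fsmul f (brFun J α β) + fsmul ((nabla J α).X f) β := by
  rw [brFun, brFun, lie_fsmul, lie_fcomb f (nabla_fsmul J f β) α, pairS_fsmul, pairS_nabla_skew J α β]
  have e : fsmul f (lie (nabla J α) β - lie (nabla J β) α - jetProlong E L (-pairS α (nabla J β))) =
      fsmul f (lie (nabla J α) β) - fsmul f (lie (nabla J β) α)
        + fsmul f (jetProlong E L (pairS α (nabla J β))) := by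
    ext x
    simp only [map_neg, fsmul_apply, Submodule.coe_sub, Submodule.coe_add, Submodule.coe_neg, Pi.sub_apply, Pi.add_apply,
      Pi.neg_apply, smul_sub, smul_neg]
    abel
  rw [e, smul_neg, map_neg]
  abel

theorem brFun_jet (J : JacobiStructure E L) (s t) :
    brFun J (jetProlong E L s) (jetProlong E L t) = jetProlong E L (J.bracket s t) := by
  rw [brFun, lie_jet, lie_jet, pairS_jet, nabla_jet, nabla_jet, J.skew t s, map_neg]
  abel

/-- The bracket of sections of `J¹L`. -/
def jetBracket (J : JacobiStructure E L) : jetSections E L →ₗ[ℝ] jetSections E L →ₗ[ℝ] jetSections E L :=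
  LinearMap.mk₂ ℝ (brFun J)
    (fun α β γ => by rw [brFun_skew, brFun_add, brFun_skew J γ, brFun_skew J γ]; abel)
    (fun c α β => by rw [brFun_skew, brFun_smul, brFun_skew J β, smul_neg, neg_neg])
    (brFun_add J) (fun c α β => brFun_smul J c α β)

theorem jetBracket_skew (J : JacobiStructure E L) (α β) : jetBracket J α β = - jetBracket J β α :=
  brFun_skew J α β

theorem jetBracket_jet (J : JacobiStructure E L) (s t) :
    jetBracket J (jetProlong E L s) (jetProlong E L t) = jetProlong E L (J.bracket s t) := brFun_jet J s t

theorem jetBracket_fsmul (J : JacobiStructure E L) (f : C^∞⟮𝓘(ℝ, E), M; ℝ⟯) (α β : jetSections E L) :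
    jetBracket J α (fsmul f β) = fsmul f (jetBracket J α β) + fsmul ((nabla J α).X f) β :=
  brFun_fsmul J f α β

theorem jet_flat (J : JacobiStructure E L) (α β : jetSections E L) (s) :
    (nabla J (jetBracket J α β)).op s = (nabla J α).op ((nabla J β).op s) - (nabla J β).op ((nabla J α).op s) := by
  let F : jetSections E L → jetSections E L → Cₛ^∞⟮𝓘(ℝ, E); ℝ, L⟯ := fun α β =>
    (nabla J (jetBracket J α β)).op s - (nabla J α).op ((nabla J β).op s) + (nabla J β).op ((nabla J α).op s)
  have hadd : ∀ α β γ, F α (β + γ) = F α β + F α γ := by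
    intro α β γ
    simp only [F, map_add, nabla_add]
    abel
  have hneg : ∀ α β, F α β = - F β α := by
    intro α β
    have h : jetBracket J α β = (-1 : ℝ) • jetBracket J β α := by
      rw [jetBracket_skew]; module
    simp only [F, h, nabla_smul, neg_one_smul]
    abel
  have hf : ∀ α (f : C^∞⟮𝓘(ℝ, E), M; ℝ⟯) β, F α (fsmul f β) = f • F α β := by
    intro α f β
    simp only [F, jetBracket_fsmul, nabla_add, nabla_fsmul, Der.op_smul, smul_sub, smul_add]
    abel
  have hj : ∀ t u, F (jetProlong E L t) (jetProlong E L u) = 0 := by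
    intro t u
    simp only [F, jetBracket_jet, nabla_jet, J.jacobi t u s]
    abel
  have h1 : ∀ t β x, F (jetProlong E L t) β x = 0 := fun t β x =>
    tensorial_eq_zero x (fun β => F (jetProlong E L t) β x) (fun α β => by rw [hadd]; rfl)
      (fun f α => by rw [hf]; rfl) (fun u => by rw [hj]; rfl) β
  have h2 : ∀ x, F α β x = 0 := fun x =>
    tensorial_eq_zero x (fun α => F α β x)
      (fun α γ => by
        rw [hneg, hadd, neg_add, ← hneg, ← hneg]; rfl)
      (fun f α => by rw [hneg, hf, ← smul_neg, ← hneg]; rfl) (fun u => h1 u β x) α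
  have h3 : F α β = 0 := by ext x; exact h2 x
  rw [← sub_eq_zero, ← h3]
  simp only [F]
  abel

theorem nabla_X_bracket (J : JacobiStructure E L) (α β : jetSections E L) (f : C^∞⟮𝓘(ℝ, E), M; ℝ⟯) :
    (nabla J (jetBracket J α β)).X f =
      (nabla J α).X ((nabla J β).X f) - (nabla J β).X ((nabla J α).X f) := by
  have h : (nabla J (jetBracket J α β)).op = ((nabla J α).comm (nabla J β)).op := by
    ext s : 1
    exact jet_flat J α β s
  exact congrFun (Der.X_eq h) f

theorem jet_jacobi (J : JacobiStructure E L) (α β γ : jetSections E L) :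
    jetBracket J α (jetBracket J β γ) =
      jetBracket J (jetBracket J α β) γ + jetBracket J β (jetBracket J α γ) := by
  let T : jetSections E L → jetSections E L → jetSections E L → jetSections E L := fun α β γ =>
    jetBracket J α (jetBracket J β γ) - jetBracket J (jetBracket J α β) γ - jetBracket J β (jetBracket J α γ)
  have hcyc : ∀ α β γ, T α β γ = T β γ α := by
    intro α β γ
    simp only [T]
    rw [jetBracket_skew J (jetBracket J α β) γ, jetBracket_skew J (jetBracket J β γ) α,
      jetBracket_skew J β α, jetBracket_skew J γ α]
    simp only [map_neg]
    abel
  have hadd : ∀ α β γ δ, T α β (γ + δ) = T α β γ + T α β δ := by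
    intro α β γ δ
    simp only [T, map_add]
    abel
  have hf : ∀ α β (f : C^∞⟮𝓘(ℝ, E), M; ℝ⟯) γ, T α β (fsmul f γ) = fsmul f (T α β γ) := by
    intro α β f γ
    simp only [T, jetBracket_fsmul, map_add, nabla_X_bracket]
    ext x
    simp only [Submodule.coe_sub, Submodule.coe_add, Pi.sub_apply, Pi.add_apply, fsmul_apply,
      ContMDiffMap.coe_sub, smul_sub, sub_smul]
    abel
  have hj : ∀ s t u, T (jetProlong E L s) (jetProlong E L t) (jetProlong E L u) = 0 := by
    intro s t u
    simp only [T, jetBracket_jet, J.jacobi s t u, map_add]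
    abel
  have tens : ∀ α β, (∀ s, T α β (jetProlong E L s) = 0) → ∀ γ, T α β γ = 0 := by
    intro α β h γ
    ext x
    exact tensorial_eq_zero x (fun γ => (T α β γ).1 x) (fun α β => by rw [hadd]; rfl)
      (fun f α => by rw [hf]; rfl) (fun u => by rw [h]; rfl) γ
  have h1 : ∀ s t γ, T (jetProlong E L s) (jetProlong E L t) γ = 0 := fun s t => tens _ _ (hj s t)
  have h2 : ∀ s β γ, T (jetProlong E L s) β γ = 0 := fun s β γ => by
    rw [hcyc]
    rw [hcyc]
    exact tens γ (jetProlong E L s) (fun u => by rw [hcyc]; exact h1 s u γ) β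
  have h3 : T α β γ = 0 := by
    rw [hcyc]
    exact tens β γ (fun s => by rw [hcyc, hcyc]; exact h2 s β γ) α
  rw [← sub_eq_zero, ← h3]
  simp only [T]
  abel

/-- The Jacobi algebroid `(J¹L, L)` of an abstract Jacobi manifold `(M, L, J)`. -/
def jetAlgebroid (J : JacobiStructure E L) : JacobiAlgebroid E L (jetSections E L) where
  bundle := jetSections_isVectorBundle
  anchor x := symbol E L x ∘ₗ sharpHat J x
  anchor_smooth α f := ((nabla J α).X f).contMDiff
  bracket := jetBracket J
  bracket_self α := by
    have h := jetBracket_skew J α α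
    ext x
    have h2 : (2 : ℝ) • (jetBracket J α α).1 x = 0 := by
      rw [two_smul]
      nth_rewrite 1 [h]
      simp
    exact (smul_eq_zero.1 h2).resolve_left two_ne_zero
  jacobi := jet_jacobi J
  leibniz α β f x := congrArg (fun β : jetSections E L => β.1 x) (jetBracket_fsmul J f α β)
  conn := sharpHat J
  conn_symbol _ _ := rfl
  conn_smooth α s := ((nabla J α).op s).contMDiff
  flat α β s x := congrArg (fun u : Cₛ^∞⟮𝓘(ℝ, E); ℝ, L⟯ => u x) (jet_flat J α β s)

theorem jetAlgebroid_anchor (J : JacobiStructure E L) (s) (x : M) :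
    (jetAlgebroid J).anchor x (jet E L x s) = hamVec J s x := rfl

theorem jetAlgebroid_bracket (J : JacobiStructure E L) (s t) :
    (jetAlgebroid J).bracket (jetProlong E L s) (jetProlong E L t) = jetProlong E L (J.bracket s t) :=
  jetBracket_jet J s t

theorem jetAlgebroid_conn (J : JacobiStructure E L) (s t) (x : M) :
    ((jetAlgebroid J).conn x (jet E L x s)).1 t = J.bracket s t x := rfl

end JetAlgebroid


section Submanifold

instance pullbackAddCommGroup {B B' : Type*} (L : B → Type*) [∀ x, AddCommGroup (L x)] (f : B' → B) (s : B') :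
    AddCommGroup ((f *ᵖ L) s) :=
  inferInstanceAs (AddCommGroup (L (f s)))

variable {E : Type*} [NormedAddCommGroup E] [NormedSpace ℝ E]
  {M : Type*} [TopologicalSpace M] [ChartedSpace E M]
  {E' : Type*} [NormedAddCommGroup E'] [NormedSpace ℝ E']
  {S : Type*} [TopologicalSpace S] [ChartedSpace E' S]
  {L : M → Type*} [TopologicalSpace (TotalSpace ℝ L)] [∀ x, AddCommGroup (L x)]
  [∀ x, Module ℝ (L x)] [∀ x, TopologicalSpace (L x)] [FiberBundle ℝ L] [VectorBundle ℝ ℝ L]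

/-- The differential `T_s S → T_{ι s} M` of the inclusion `ι : S → M`. -/
def incl (ι : C^∞⟮𝓘(ℝ, E'), S; 𝓘(ℝ, E), M⟯) (s : S) :
    TangentSpace 𝓘(ℝ, E') s →L[ℝ] TangentSpace 𝓘(ℝ, E) (ι s) :=
  mfderiv 𝓘(ℝ, E') 𝓘(ℝ, E) ι s

/-- The tangent space of `S` at `s`, as a subspace of the tangent space of `M`. -/
def tangent (ι : C^∞⟮𝓘(ℝ, E'), S; 𝓘(ℝ, E), M⟯) (s : S) : Submodule ℝ (TangentSpace 𝓘(ℝ, E) (ι s)) :=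
  LinearMap.range (incl ι s).toLinearMap

/-- The conormal space `N*_s S ⊂ T*_s M`: the annihilator of `T_s S`. -/
def annihilator (ι : C^∞⟮𝓘(ℝ, E'), S; 𝓘(ℝ, E), M⟯) (s : S) :
    Submodule ℝ (TangentSpace 𝓘(ℝ, E) (ι s) →L[ℝ] ℝ) where
  carrier := {ξ | ∀ v ∈ tangent ι s, ξ v = 0}
  add_mem' h h' v hv := by
    rw [add_apply, h v hv, h' v hv, add_zero]
  zero_mem' _ _ := rfl
  smul_mem' c ξ h v hv := by
    rw [smul_apply, h v hv, smul_zero]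

theorem dAt_comp (ι : C^∞⟮𝓘(ℝ, E'), S; 𝓘(ℝ, E), M⟯) (f : C^∞⟮𝓘(ℝ, E), M; ℝ⟯) (s : S)
    (v : TangentSpace 𝓘(ℝ, E') s) : dAt (f.comp ι) s v = dAt f (ι s) (incl ι s v) := by
  have h := mfderiv_comp s (f.contMDiff.mdifferentiable (by simp) (ι s)) (ι.contMDiff.mdifferentiable (by simp) s)
  exact congrArg (fun φ : TangentSpace 𝓘(ℝ, E') s →L[ℝ] ℝ => φ v) h

theorem restrict_smooth (ι : C^∞⟮𝓘(ℝ, E'), S; 𝓘(ℝ, E), M⟯) (u : Cₛ^∞⟮𝓘(ℝ, E); ℝ, L⟯)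
    (r : ∀ s, ((ι : S → M) *ᵖ L) s) (hr : ∀ s, r s = u (ι s)) :
    ContMDiff 𝓘(ℝ, E') (𝓘(ℝ, E').prod 𝓘(ℝ, ℝ)) ∞
      fun s => (TotalSpace.mk' ℝ s (r s) : TotalSpace ℝ ((ι : S → M) *ᵖ L)) := by
  intro s
  refine (Bundle.contMDiffAt_section (E := (ι : S → M) *ᵖ L) s).2 ?_
  refine (((Bundle.contMDiffAt_section (ι s)).1 (u.contMDiff (ι s))).comp s (ι.contMDiff s)).congr_of_eventuallyEq ?_
  refine Filter.Eventually.of_forall fun t => ?_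
  change ((trivializationAt ℝ L (ι s)) ⟨ι t, r t⟩).2 = ((trivializationAt ℝ L (ι s)) ⟨ι t, u (ι t)⟩).2
  rw [hr]

/-- The restriction `λ|_S` of a section of `L`, a section of the line bundle `ℓ = L|_S = ι*L`. -/
def restrict (ι : C^∞⟮𝓘(ℝ, E'), S; 𝓘(ℝ, E), M⟯) :
    Cₛ^∞⟮𝓘(ℝ, E); ℝ, L⟯ →ₗ[ℝ] Cₛ^∞⟮𝓘(ℝ, E'); ℝ, (ι : S → M) *ᵖ L⟯ where
  toFun u := ⟨fun s => (u (ι s) : L (ι s)), restrict_smooth ι u _ fun _ => rfl⟩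
  map_add' _ _ := rfl
  map_smul' _ _ := rfl

theorem restrict_apply (ι : C^∞⟮𝓘(ℝ, E'), S; 𝓘(ℝ, E), M⟯) (u : Cₛ^∞⟮𝓘(ℝ, E); ℝ, L⟯) (s : S) :
    restrict ι u s = u (ι s) := rfl

theorem restrict_smul (ι : C^∞⟮𝓘(ℝ, E'), S; 𝓘(ℝ, E), M⟯) (f : C^∞⟮𝓘(ℝ, E), M; ℝ⟯)
    (u : Cₛ^∞⟮𝓘(ℝ, E); ℝ, L⟯) : restrict ι (f • u) = (f.comp ι) • restrict ι u := rfl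

variable (L) in
/-- The map `der_s ℓ → der_{ι s} L` induced by the regular morphism `ℓ → L`: `δ ↦ (λ ↦ δ(λ|_S))`. -/
def derPush (ι : C^∞⟮𝓘(ℝ, E'), S; 𝓘(ℝ, E), M⟯) (s : S) :
    derFiber E' ((ι : S → M) *ᵖ L) s →ₗ[ℝ] derFiber E L (ι s) :=
  { toFun := fun δ => ⟨⟨⟨fun u => (δ.1 (restrict ι u) : L (ι s)),
        fun u v => (congrArg δ.1 (map_add (restrict ι) u v)).trans (map_add δ.1 (restrict ι u) (restrict ι v))⟩,
        fun c u => (congrArg δ.1 (map_smul (restrict ι) c u)).trans (map_smul δ.1 c (restrict ι u))⟩, by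
      obtain ⟨v, hv⟩ := δ.2
      refine ⟨incl ι s v, fun f u => ?_⟩
      have h := hv (f.comp ι) (restrict ι u)
      rw [dAt_comp, ← restrict_smul] at h
      exact h⟩
    map_add' := fun _ _ => rfl
    map_smul' := fun _ _ => rfl }

theorem derPush_apply (ι : C^∞⟮𝓘(ℝ, E'), S; 𝓘(ℝ, E), M⟯) (s : S)
    (δ : derFiber E' ((ι : S → M) *ᵖ L) s) (u : Cₛ^∞⟮𝓘(ℝ, E); ℝ, L⟯) :
    (derPush L ι s δ).1 u = δ.1 (restrict ι u) := rfl

section Subbundle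
variable {A : M → Type*} [∀ x, AddCommGroup (A x)] [∀ x, Module ℝ (A x)]

/-- Smooth sections of the restriction `A|_S` of a vector bundle `A` with smooth sections `ΓA`. -/
def IsSmoothAlong (ΓA : Submodule ℝ (∀ x, A x)) (ι : C^∞⟮𝓘(ℝ, E'), S; 𝓘(ℝ, E), M⟯)
    (β : ∀ s, A (ι s)) : Prop :=
  ∀ s, ∃ α ∈ ΓA, ∀ᶠ t in 𝓝 s, β t = α (ι t)

/-- Smooth sections of a family `B` of subspaces of `A|_S`. -/
def IsSection (ΓA : Submodule ℝ (∀ x, A x)) (ι : C^∞⟮𝓘(ℝ, E'), S; 𝓘(ℝ, E), M⟯)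
    (B : ∀ s, Submodule ℝ (A (ι s))) (β : ∀ s, A (ι s)) : Prop :=
  IsSmoothAlong ΓA ι β ∧ ∀ s, β s ∈ B s

/-- `B` is a smooth vector subbundle of `A` over `S`: around every point it has a smooth local frame. -/
def IsSubbundle (ΓA : Submodule ℝ (∀ x, A x)) (ι : C^∞⟮𝓘(ℝ, E'), S; 𝓘(ℝ, E), M⟯)
    (B : ∀ s, Submodule ℝ (A (ι s))) : Prop :=
  ∀ s, ∃ (n : ℕ) (b : Fin n → ∀ t, A (ι t)), (∀ i, IsSmoothAlong ΓA ι (b i)) ∧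
    ∀ᶠ t in 𝓝 s, LinearIndependent ℝ (fun i => b i t) ∧ Submodule.span ℝ (Set.range fun i => b i t) = B t

variable [FiniteDimensional ℝ E] [IsManifold 𝓘(ℝ, E) ∞ M] [T2Space M]
  [ContMDiffVectorBundle ∞ ℝ L 𝓘(ℝ, E)]

/-- `(B, ℓ)`, with `ℓ = L|_S`, is a Jacobi subalgebroid over `S` of the Jacobi algebroid `(A, L)`. -/
structure IsJacobiSubalgebroid {ΓA : Submodule ℝ (∀ x, A x)} (𝒜 : JacobiAlgebroid E L ΓA)
    (ι : C^∞⟮𝓘(ℝ, E'), S; 𝓘(ℝ, E), M⟯) (B : ∀ s, Submodule ℝ (A (ι s))) : Prop where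
  subbundle : IsSubbundle ΓA ι B
  /-- The anchor descends to a vector bundle morphism `B → TS`. -/
  anchor : ∃ ρB : ∀ s, B s →ₗ[ℝ] TangentSpace 𝓘(ℝ, E') s,
    (∀ s b, incl ι s (ρB s b) = 𝒜.anchor (ι s) b.1) ∧
    ∀ (β : ∀ s, A (ι s)) (hβ : IsSection ΓA ι B β) (f : C^∞⟮𝓘(ℝ, E'), S; ℝ⟯),
      ContMDiff 𝓘(ℝ, E') 𝓘(ℝ, ℝ) ∞ fun s => dAt f s (ρB s ⟨β s, hβ.2 s⟩)
  /-- The bracket descends to sections of `B`. -/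
  bracket : ∀ β β' : ∀ s, A (ι s), IsSection ΓA ι B β → IsSection ΓA ι B β' →
    ∃ γ : ∀ s, A (ι s), IsSection ΓA ι B γ ∧ ∀ α α' : ΓA, (∀ s, α.1 (ι s) = β s) →
      (∀ s, α'.1 (ι s) = β' s) → ∀ s, (𝒜.bracket α α').1 (ι s) = γ s
  /-- The connection descends to a vector bundle morphism `B → der ℓ`. -/
  conn : ∃ D : ∀ s, B s →ₗ[ℝ] derFiber E' ((ι : S → M) *ᵖ L) s,
    (∀ s b, derPush L ι s (D s b) = 𝒜.conn (ι s) b.1) ∧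
    ∀ (β : ∀ s, A (ι s)) (hβ : IsSection ΓA ι B β) (ε : Cₛ^∞⟮𝓘(ℝ, E'); ℝ, (ι : S → M) *ᵖ L⟯),
      ContMDiff 𝓘(ℝ, E') (𝓘(ℝ, E').prod 𝓘(ℝ, ℝ)) ∞ fun s =>
        (TotalSpace.mk' ℝ s ((D s ⟨β s, hβ.2 s⟩).1 ε) : TotalSpace ℝ ((ι : S → M) *ᵖ L))

end Subbundle

variable [FiniteDimensional ℝ E] [IsManifold 𝓘(ℝ, E) ∞ M] [T2Space M]
  [ContMDiffVectorBundle ∞ ℝ L 𝓘(ℝ, E)]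

/-- `S` is coisotropic: `Λ_J^♯(T_s⁰S ⊗ L_s) ⊂ T_s S` for every `s`. -/
def IsCoisotropic (J : JacobiStructure E L) (ι : C^∞⟮𝓘(ℝ, E'), S; 𝓘(ℝ, E), M⟯) : Prop :=
  ∀ s, ∀ ξ ∈ annihilator ι s, ∀ w : L (ι s), sharp J (ι s) ξ w ∈ tangent ι s

variable (L) in
/-- The bundle `N_ℓ*S = N*S ⊗ ℓ`, embedded in `J¹L|_S` by the co-symbol: the fibre at `s` is the image
`γ(N*_s S ⊗ L_s)`. -/
def conormal (ι : C^∞⟮𝓘(ℝ, E'), S; 𝓘(ℝ, E), M⟯) (s : S) : Submodule ℝ (JetFiber E L (ι s)) :=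
  Submodule.map₂ (cosymbol E L (ι s)) (annihilator ι s) ⊤

end Submanifold

end Jac
end

/-! The anchor of `γ(ξ ⊗ w)` is by definition `Λ_J^♯(ξ ⊗ w)`, so the anchor condition for the
conormal bundle contains coisotropy. This settles one direction (`isCoisotropic_of_subalgebroid`).

For the other direction, pairing a co-symbol with a derivation gives `Λ̂_J(a, γ(θ ⊗ u)) = θ(σ(Λ̂_J^♯
a)) u`. If `S` is coisotropic and `a` is conormal, the symbol on the right is tangent to `S`. A
conormal `θ` kills it, so the conormal bundle is isotropic for `Λ̂_J` (`lambdaHat_conormal`).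
Moreover, the jet along `S` of a section that vanishes on `S` is conormal (`jet_mem_conormal`), and
such jets give local frames: `j¹(g_i e)`, with local equations `g_i` of `S` and a nonvanishing
section `e` (`exists_conormal_frame`). The subalgebroid conditions follow from these facts.

Anchor: it takes values in `TS`, and the injective differential of `ι` can be inverted on its image.

Bracket: the anchors of conormal sections are tangent to `S`, so by the Leibniz rule an argument
that vanishes along `S` contributes nothing (`jetBracket_eq_zero`). Hence the bracket depends on
restrictions only, and both arguments may be expanded in the frame. The frame elements satisfy
`[j¹b_i, j¹b_j] = j¹{b_i, b_j}`, where `{b_i, b_j}` vanishes on `S` by isotropy. The result is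
therefore conormal again (`jetBracket_mem_conormal`).

Connection: a conormal `a` kills every section that vanishes on `S`, again by isotropy. So `∇_a u`
depends on `u|_S` only and defines a derivation of `ℓ` (`exists_conormal_der`).

Smoothness is always checked by extending functions and sections locally from `S` to `M`, which the
normal form of an immersion permits. -/

noncomputable section
namespace Jac

/-! ### Extension of functions from an immersed submanifold, and its local equations. -/

section Extension

variable {E : Type*} [NormedAddCommGroup E] [NormedSpace ℝ E] [FiniteDimensional ℝ E]
  {M : Type*} [TopologicalSpace M] [ChartedSpace E M] [IsManifold 𝓘(ℝ, E) ∞ M] [T2Space M]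

/-- The germ at `x` of a function that is smooth near `x` is the germ of a global smooth function. -/
theorem exists_global_of_contMDiffOn {x : M} {U : Set M} (hU : U ∈ 𝓝 x) {h : M → ℝ}
    (hh : ∀ y ∈ U, ContMDiffAt 𝓘(ℝ, E) 𝓘(ℝ, ℝ) ∞ h y) :
    ∃ F : C^∞⟮𝓘(ℝ, E), M; ℝ⟯, ∀ᶠ y in 𝓝 x, F y = h y := by
  obtain ⟨χ, h1, h2⟩ := exists_bump (E := E) x hU
  refine ⟨⟨fun y => χ y • h y, contMDiff_of_tsupport fun y hy =>
    χ.contMDiff.contMDiffAt.smul (hh y (h2 (tsupport_smul_subset_left _ _ hy)))⟩, ?_⟩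
  filter_upwards [h1] with y hy
  change χ y • h y = h y
  rw [hy, one_smul]

variable {E' : Type*} [NormedAddCommGroup E'] [NormedSpace ℝ E']
  {S : Type*} [TopologicalSpace S] [ChartedSpace E' S]

/-- The normal form of an immersion, moved from coordinates to points of `S`. The first component
recovers the chart of `S`, hence extensions of functions; the second one supplies local equations.
-/
theorem codChart_immersion {f : S → M} {s : S} (h : Manifold.IsImmersionAt 𝓘(ℝ, E') 𝓘(ℝ, E) ∞ f s) :
    ∀ᶠ t in 𝓝 s, h.equiv.symm (h.codChart (f t)) = (h.domChart t, 0) := by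
  filter_upwards [h.domChart.open_source.mem_nhds h.mem_domChart_source] with t ht
  have ht' : h.domChart t ∈ (h.domChart.extend 𝓘(ℝ, E')).target := by simpa using h.domChart.map_source ht
  have h1 := h.writtenInCharts ht'
  simp only [OpenPartialHomeomorph.extend_coe, OpenPartialHomeomorph.extend_coe_symm, modelWithCornersSelf_coe,
    modelWithCornersSelf_coe_symm, Function.comp_apply, id_eq, h.domChart.left_inv ht] at h1
  rw [h1, ContinuousLinearEquiv.symm_apply_apply]

theorem contMDiffAt_codChart {f : S → M} {s : S} (h : Manifold.IsImmersionAt 𝓘(ℝ, E') 𝓘(ℝ, E) ∞ f s)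
    {y : M} (hy : y ∈ h.codChart.source) : ContMDiffAt 𝓘(ℝ, E) 𝓘(ℝ, E) ∞ h.codChart y :=
  contMDiffAt_of_mem_maximalAtlas h.codChart_mem_maximalAtlas hy

/-- Locally, smooth functions on an immersed submanifold extend. -/
theorem exists_extension [IsManifold 𝓘(ℝ, E') ∞ S] (ι : C^∞⟮𝓘(ℝ, E'), S; 𝓘(ℝ, E), M⟯) {s : S}
    (h : Manifold.IsImmersionAt 𝓘(ℝ, E') 𝓘(ℝ, E) ∞ ι s) (f : C^∞⟮𝓘(ℝ, E'), S; ℝ⟯) :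
    ∃ F : C^∞⟮𝓘(ℝ, E), M; ℝ⟯, ∀ᶠ t in 𝓝 s, F (ι t) = f t := by
  -- In the adapted charts this is the projection of `M` onto `S` along the complement; composing a
  -- function on `S` with it gives the extension.
  let P : M → E' := fun y => (h.equiv.symm (h.codChart y)).1
  have hP : ∀ y ∈ h.codChart.source, ContMDiffAt 𝓘(ℝ, E) 𝓘(ℝ, E') ∞ P y := fun y hy =>
    (contDiff_fst.comp h.equiv.symm.contDiff).contMDiff.contMDiffAt.comp y (contMDiffAt_codChart h hy)
  have hPs : P (ι s) = h.domChart s := congrArg Prod.fst (codChart_immersion h).self_of_nhds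
  have hU : h.codChart.source ∩ P ⁻¹' h.domChart.target ∈ 𝓝 (ι s) := by
    refine Filter.inter_mem (h.codChart.open_source.mem_nhds h.mem_codChart_source) ?_
    refine (hP _ h.mem_codChart_source).continuousAt (h.domChart.open_target.mem_nhds ?_)
    rw [hPs]
    exact h.domChart.map_source h.mem_domChart_source
  obtain ⟨F, hF⟩ := exists_global_of_contMDiffOn (h := fun y => f (h.domChart.symm (P y))) hU
    fun y hy => f.contMDiff.contMDiffAt.comp y
      ((contMDiffAt_symm_of_mem_maximalAtlas h.domChart_mem_maximalAtlas hy.2).comp y (hP y hy.1))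
  refine ⟨F, ?_⟩
  filter_upwards [ι.contMDiff.continuous.continuousAt.eventually hF, codChart_immersion h,
    h.domChart.open_source.mem_nhds h.mem_domChart_source] with t h1 h2 h3
  have h4 : P (ι t) = h.domChart t := congrArg Prod.fst h2
  rw [h1, h4, h.domChart.left_inv h3]

/-- Tangent vectors of `S` are separated by functions on `S`. Each such `f` agrees near `s` with
some `F ∘ ι`, and `d(F ∘ ι)` factors through the differential of `ι`. -/
theorem incl_injective [FiniteDimensional ℝ E'] [IsManifold 𝓘(ℝ, E') ∞ S] [T2Space S]
    (ι : C^∞⟮𝓘(ℝ, E'), S; 𝓘(ℝ, E), M⟯) {s : S}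
    (h : Manifold.IsImmersionAt 𝓘(ℝ, E') 𝓘(ℝ, E) ∞ ι s) : Function.Injective (incl ι s) := by
  rw [injective_iff_map_eq_zero]
  intro v hv
  refine eq_zero_of_dAt v fun f => ?_
  obtain ⟨F, hF⟩ := exists_extension ι h f
  have h1 : dAt (F.comp ι) s = dAt f s := dAt_congr hF
  rw [← h1, dAt_comp, hv, map_zero]

/-- Local equations of an immersed submanifold, together with tangent vectors dual to their differentials. -/
theorem exists_equations (ι : C^∞⟮𝓘(ℝ, E'), S; 𝓘(ℝ, E), M⟯) {s : S}
    (h : Manifold.IsImmersionAt 𝓘(ℝ, E') 𝓘(ℝ, E) ∞ ι s) :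
    ∃ (n : ℕ) (g : Fin n → C^∞⟮𝓘(ℝ, E), M; ℝ⟯) (v : Fin n → TangentSpace 𝓘(ℝ, E) (ι s)),
      n + Module.finrank ℝ E' = Module.finrank ℝ E ∧ (∀ i, ∀ᶠ t in 𝓝 s, g i (ι t) = 0) ∧
      ∀ i j, dAt (g i) (ι s) (v j) = if i = j then 1 else 0 := by
  have i1 : FiniteDimensional ℝ (E' × h.complement) := Module.Finite.equiv h.equiv.symm.toLinearEquiv
  have i2 : FiniteDimensional ℝ h.complement := Module.Finite.of_surjective
    (LinearMap.snd ℝ E' h.complement) LinearMap.snd_surjective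
  have i3 : FiniteDimensional ℝ E' := Module.Finite.of_surjective
    (LinearMap.fst ℝ E' h.complement) LinearMap.fst_surjective
  let b := Module.finBasis ℝ h.complement
  -- The coordinates transverse to `S` in the adapted chart; cut off, they become the equations `g
  -- i`.
  let C : Fin (Module.finrank ℝ h.complement) → E →L[ℝ] ℝ := fun i =>
    (b.coord i).toContinuousLinearMap ∘L ContinuousLinearMap.snd ℝ E' h.complement ∘L h.equiv.symm.toContinuousLinearMap
  have hsrc := h.codChart.open_source.mem_nhds h.mem_codChart_source
  choose g hg using fun i => exists_global_of_contMDiffOn (E := E) (h := fun y => C i (h.codChart y)) hsrc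
    fun y hy => (C i).contDiff.contMDiff.contMDiffAt.comp y (contMDiffAt_codChart h hy)
  set p : E := h.codChart (ι s) with hp
  have hpt : p ∈ h.codChart.target := h.codChart.map_source h.mem_codChart_source
  have hq : h.codChart.symm p = ι s := h.codChart.left_inv h.mem_codChart_source
  have hqs : ContMDiffAt 𝓘(ℝ, E) 𝓘(ℝ, E) ∞ h.codChart.symm p :=
    contMDiffAt_symm_of_mem_maximalAtlas h.codChart_mem_maximalAtlas hpt
  -- The coordinate vectors transverse to `S`, on which the forms `C i` are the dual basis.
  let w : Fin (Module.finrank ℝ h.complement) → E := fun j => h.equiv (0, b j)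
  refine ⟨_, g, fun j => (mfderiv 𝓘(ℝ, E) 𝓘(ℝ, E) h.codChart.symm p : E →L[ℝ] E) (w j), ?_, fun i => ?_, fun i j => ?_⟩
  · rw [← h.equiv.toLinearEquiv.finrank_eq, Module.finrank_prod, add_comm]
  · filter_upwards [ι.contMDiff.continuous.continuousAt.eventually (hg i), codChart_immersion h] with t h1 h2
    rw [h1]
    change b.coord i (h.equiv.symm (h.codChart (ι t))).2 = 0
    rw [h2, map_zero]
  · have h1 : ∀ᶠ z in 𝓝 p, g i (h.codChart.symm z) = C i z := by
      have h2 := hqs.continuousAt.eventually (p := fun y => g i y = C i (h.codChart y)) (by rw [hq]; exact hg i)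
      filter_upwards [h2, h.codChart.open_target.mem_nhds hpt] with z hz hz'
      rw [hz, h.codChart.right_inv hz']
    have h3 : mfderiv 𝓘(ℝ, E) 𝓘(ℝ, ℝ) (g i ∘ h.codChart.symm) p = C i :=
      (Filter.EventuallyEq.mfderiv_eq (f₁ := g i ∘ h.codChart.symm) (f := C i) h1).trans
        (mfderiv_eq_fderiv.trans (C i).fderiv)
    have h4 := mfderiv_comp p ((g i).contMDiff.mdifferentiable (by simp) (h.codChart.symm p))
      (hqs.mdifferentiableAt (by simp))
    have h5 : dAt (g i) (h.codChart.symm p) ((mfderiv 𝓘(ℝ, E) 𝓘(ℝ, E) h.codChart.symm p : E →L[ℝ] E) (w j)) =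
        C i (w j) := by
      rw [← h3, h4]; rfl
    -- The points `h.codChart.symm p` and `ι s` are equal only propositionally; since every tangent
    -- space is `E`, substituting the point moves the identity to `ι s`.
    have h6 : ∀ y (hy : y = ι s) (u : E), dAt (g i) y u = dAt (g i) (ι s) u := by
      rintro _ rfl u; rfl
    refine ((h6 _ hq _).symm.trans h5).trans ?_
    change b.coord i (h.equiv.symm (h.equiv (0, b j))).2 = _
    rw [ContinuousLinearEquiv.symm_apply_apply, Module.Basis.coord_apply, Module.Basis.repr_self,
      Finsupp.single_apply]
    simp [eq_comm]

/-- Local equations of an immersed submanifold, together with dual derivations. -/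
theorem exists_slice (ι : C^∞⟮𝓘(ℝ, E'), S; 𝓘(ℝ, E), M⟯) {s : S}
    (h : Manifold.IsImmersionAt 𝓘(ℝ, E') 𝓘(ℝ, E) ∞ ι s) :
    ∃ (n : ℕ) (g : Fin n → C^∞⟮𝓘(ℝ, E), M; ℝ⟯)
      (D : Fin n → C^∞⟮𝓘(ℝ, E), M; ℝ⟯ →ₗ[ℝ] C^∞⟮𝓘(ℝ, E), M; ℝ⟯),
      n + Module.finrank ℝ E' = Module.finrank ℝ E ∧ (∀ᶠ t in 𝓝 s, ∀ i, g i (ι t) = 0) ∧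
      (∀ j f f', D j (f * f') = f * D j f' + f' * D j f) ∧
      ∀ᶠ y in 𝓝 (ι s), ∀ i j, D j (g i) y = if i = j then 1 else 0 := by
  obtain ⟨n, g, v, hn, hg, hv⟩ := exists_equations ι h
  choose D hD hDx using fun j => exists_derivation (E := E) (ι s) (v j)
  -- Extending the dual vectors to derivations preserves duality at `ι s` only. This matrix is the
  -- identity there, hence invertible nearby, and correcting by its inverse restores duality on a
  -- neighbourhood.
  let G : Matrix (Fin n) (Fin n) C^∞⟮𝓘(ℝ, E), M; ℝ⟯ := fun k i => D k (g i)
  have hdet : G.det (ι s) = 1 := by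
    have h1 := RingHom.map_det
      (ContMDiffMap.evalRingHom (I := 𝓘(ℝ, E)) (I' := 𝓘(ℝ, ℝ)) (n := ∞) (R := ℝ) (ι s)) G
    have h2 : (ContMDiffMap.evalRingHom (I := 𝓘(ℝ, E)) (I' := 𝓘(ℝ, ℝ)) (n := ∞) (R := ℝ) (ι s)).mapMatrix G = 1 := by
      ext k i
      change D k (g i) (ι s) = _
      rw [hDx, hv, Matrix.one_apply]
      simp [eq_comm]
    rw [h2, Matrix.det_one] at h1
    exact h1
  obtain ⟨d, hd⟩ := exists_local_inv G.det (by rw [hdet]; exact one_ne_zero)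
  -- The new derivations are the rows of `G⁻¹ = d · adj G` applied to the old ones, where `d` is a
  -- local inverse of `det G`.
  refine ⟨n, g, fun j => ∑ k, LinearMap.mulLeft ℝ (d * G.adjugate j k) ∘ₗ D k, hn, Filter.eventually_all.2 hg,
    fun j f f' => ?_, ?_⟩
  · simp only [LinearMap.sum_apply, LinearMap.comp_apply, LinearMap.mulLeft_apply, hD, Finset.mul_sum,
      ← Finset.sum_add_distrib]
    exact Finset.sum_congr rfl fun k _ => by ring
  · filter_upwards [hd] with y hy i j
    have h1 : (∑ k, LinearMap.mulLeft ℝ (d * G.adjugate j k) ∘ₗ D k) (g i) =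
        d * (G.adjugate * G) j i := by
      rw [Matrix.mul_apply, Finset.mul_sum, LinearMap.sum_apply]
      exact Finset.sum_congr rfl fun k _ => mul_assoc _ _ _
    rw [h1, Matrix.adjugate_mul, Matrix.smul_apply, Matrix.one_apply]
    by_cases hij : j = i
    · simpa [hij] using hy
    · simp [hij, Ne.symm hij]

end Extension

/-! ### Conormal jets, and isotropy of the conormal bundle of a coisotropic submanifold. -/

section Conormal

variable {E : Type*} [NormedAddCommGroup E] [NormedSpace ℝ E] [FiniteDimensional ℝ E]
  {M : Type*} [TopologicalSpace M] [ChartedSpace E M] [IsManifold 𝓘(ℝ, E) ∞ M] [T2Space M]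
  {L : M → Type*} [TopologicalSpace (TotalSpace ℝ L)] [∀ x, AddCommGroup (L x)]
  [∀ x, Module ℝ (L x)] [∀ x, TopologicalSpace (L x)] [FiberBundle ℝ L] [VectorBundle ℝ ℝ L]
  [ContMDiffVectorBundle ∞ ℝ L 𝓘(ℝ, E)]
  {E' : Type*} [NormedAddCommGroup E'] [NormedSpace ℝ E']
  {S : Type*} [TopologicalSpace S] [ChartedSpace E' S]
  {ι : C^∞⟮𝓘(ℝ, E'), S; 𝓘(ℝ, E), M⟯} {J : JacobiStructure E L}

theorem cosymbol_mem_conormal {s : S} {ξ : TangentSpace 𝓘(ℝ, E) (ι s) →L[ℝ] ℝ} (hξ : ξ ∈ annihilator ι s)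
    (w : L (ι s)) : cosymbol E L (ι s) ξ w ∈ conormal L ι s :=
  Submodule.apply_mem_map₂ _ hξ Submodule.mem_top

/-- The differential of a function that vanishes on `S` is conormal. -/
theorem dAt_mem_annihilator {s : S} {f : C^∞⟮𝓘(ℝ, E), M; ℝ⟯} (hf : ∀ᶠ t in 𝓝 s, f (ι t) = 0) :
    dAt f (ι s) ∈ annihilator ι s := by
  rintro _ ⟨v, rfl⟩
  change dAt f (ι s) (incl ι s v) = 0
  have h1 : dAt (f.comp ι) s = dAt (0 : C^∞⟮𝓘(ℝ, E'), S; ℝ⟯) s := dAt_congr hf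
  have h2 : dAt (0 : C^∞⟮𝓘(ℝ, E'), S; ℝ⟯) s = 0 := mfderiv_const
  rw [← dAt_comp, h1, h2]
  rfl

theorem frame_coeff {c : Cₛ^∞⟮𝓘(ℝ, E); ℝ, L⟯ →ₗ[C^∞⟮𝓘(ℝ, E), M; ℝ⟯] C^∞⟮𝓘(ℝ, E), M; ℝ⟯}
    {e : Cₛ^∞⟮𝓘(ℝ, E); ℝ, L⟯} {χ : C^∞⟮𝓘(ℝ, E), M; ℝ⟯} (hce : ∀ s, c s • e = χ • s) {y : M} (hy : χ y = 1)
    (u : Cₛ^∞⟮𝓘(ℝ, E); ℝ, L⟯) : c u y • e y = u y := by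
  have h := congrArg (fun s : Cₛ^∞⟮𝓘(ℝ, E); ℝ, L⟯ => s y) (hce u)
  simpa only [smul_section_apply, hy, one_smul] using h

/-- The first jet of a section that vanishes on `S` is conormal. -/
theorem jet_mem_conormal {s : S} {u : Cₛ^∞⟮𝓘(ℝ, E); ℝ, L⟯} (hu : ∀ᶠ t in 𝓝 s, u (ι t) = 0) :
    jet E L (ι s) u ∈ conormal L ι s := by
  obtain ⟨c, e, χ, hχ, hce, he, -⟩ := exists_frame E L (ι s)
  have hι : ContinuousAt ι s := ι.contMDiff.continuous.continuousAt
  have hc : ∀ᶠ t in 𝓝 s, c u (ι t) = 0 := by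
    filter_upwards [hu, hι.eventually hχ, hι.eventually he] with t h1 h2 h3
    have h4 := frame_coeff hce h2 u
    rw [h1] at h4
    exact (smul_eq_zero.1 h4).resolve_right h3
  -- The second summand vanishes near `ι s` and has no jet there, so only `c u • e` matters.
  have e1 : u = c u • e + (1 - χ) • u := by rw [hce, sub_smul, one_smul]; abel
  have e2 : jet E L (ι s) ((1 - χ) • u) = 0 := by
    refine (Submodule.Quotient.mk_eq_zero _).2 (mem_zeroJets_of_fn (mem_sq_of_eventually_zero ?_) u)
    filter_upwards [hχ] with y hy
    simp [hy]
  -- In `γ(df ⊗ e) = j¹(f e) - f j¹e` the last term drops out, because `f = c u` vanishes on `S`.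
  have e3 : jet E L (ι s) u = cosymbol E L (ι s) (dAt (c u) (ι s)) (e (ι s)) := by
    rw [cosymbol_dAt, hc.self_of_nhds, zero_smul, sub_zero]
    conv_lhs => rw [e1]
    rw [map_add, e2, add_zero]
  rw [e3]
  exact cosymbol_mem_conormal (dAt_mem_annihilator hc) _

/-- Coisotropy is stated on pure tensors `ξ ⊗ w`; since the tangent space is a linear subspace, it
passes to everything they span. -/
theorem anchor_mem_tangent (hJ : IsCoisotropic J ι) {s : S} {a : JetFiber E L (ι s)}
    (ha : a ∈ conormal L ι s) : symbol E L (ι s) (sharpHat J (ι s) a) ∈ tangent ι s := by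
  have h : conormal L ι s ≤ (tangent ι s).comap (symbol E L (ι s) ∘ₗ sharpHat J (ι s)) :=
    Submodule.map₂_le.2 fun ξ hξ w _ => hJ s ξ hξ w
  exact h ha

/-- The conormal bundle of a coisotropic submanifold is isotropic for `Λ̂_J`. -/
theorem lambdaHat_conormal (hJ : IsCoisotropic J ι) {s : S} {a b : JetFiber E L (ι s)}
    (ha : a ∈ conormal L ι s) (hb : b ∈ conormal L ι s) : lambdaHat J (ι s) a b = 0 := by
  have h : conormal L ι s ≤ LinearMap.ker (lambdaHat J (ι s) a) := by
    refine Submodule.map₂_le.2 fun ξ hξ w _ => ?_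
    -- The value at `γ(ξ ⊗ w)` is `ξ`, evaluated on a vector tangent to `S`, times `w`.
    rw [LinearMap.mem_ker, ← jetPair_sharpHat, jetPair_cosymbol, hξ _ (anchor_mem_tangent hJ ha), zero_smul]
  exact h hb

/-- Isotropy, applied to the conormal element `j¹u`. This is what makes the connection descend to
`ℓ`. -/
theorem sharpHat_eq_zero (hJ : IsCoisotropic J ι) {s : S} {a : JetFiber E L (ι s)}
    (ha : a ∈ conormal L ι s) {u : Cₛ^∞⟮𝓘(ℝ, E); ℝ, L⟯} (hu : ∀ᶠ t in 𝓝 s, u (ι t) = 0) :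
    (sharpHat J (ι s) a).1 u = 0 :=
  lambdaHat_conormal hJ ha (jet_mem_conormal hu)

/-! ### Dependence of the bracket on the restrictions to `S`. -/

theorem jetSections_sum_apply {n : ℕ} (β : Fin n → jetSections E L) (x : M) :
    (∑ i, β i).1 x = ∑ i, (β i).1 x := by
  rw [Submodule.coe_sum, Finset.sum_apply]

/-- The bracket of jet sections is local. -/
theorem jetBracket_eq_zero_of_eventually (α : jetSections E L) {β : jetSections E L} {x : M}
    (hβ : ∀ᶠ y in 𝓝 x, β.1 y = 0) : (jetBracket J α β).1 x = 0 := by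
  obtain ⟨χ, h1, h2⟩ := exists_bump (E := E) x hβ
  have e : β = fsmul (1 - χ) β := by
    ext y
    by_cases hy : y ∈ tsupport χ
    · have : β.1 y = 0 := h2 hy
      simp [this]
    · simp [image_eq_zero_of_notMem_tsupport hy]
  rw [e, jetBracket_fsmul]
  change (1 - χ x) • _ + _ • β.1 x = 0
  rw [h1.self_of_nhds, hβ.self_of_nhds, sub_self, zero_smul, smul_zero, add_zero]

/-- If the anchor of `α` is tangent to `S`, then `[α, β]|_S` depends on `β|_S` only. -/
theorem jetBracket_eq_zero {s : S} {α β : jetSections E L}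
    (hα : symbol E L (ι s) (sharpHat J (ι s) (α.1 (ι s))) ∈ tangent ι s)
    (hβ : ∀ᶠ t in 𝓝 s, β.1 (ι t) = 0) : (jetBracket J α β).1 (ι s) = 0 := by
  obtain ⟨n, e, he, hc⟩ := jet_frame (E := E) (L := L) (ι s)
  obtain ⟨c, hc⟩ := hc β
  have hι : ContinuousAt ι s := ι.contMDiff.continuous.continuousAt
  -- In a frame of `J¹L`, vanishing along `S` passes to each coefficient.
  have hc0 : ∀ i, ∀ᶠ t in 𝓝 s, c i (ι t) = 0 := fun i => by
    filter_upwards [hβ, hι.eventually he, hι.eventually hc] with t h1 h2 h3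
    exact Fintype.linearIndependent_iff.1 h2.1 (fun i => c i (ι t)) (h3.symm.trans h1) i
  have e1 : β = (β - ∑ i, fsmul (c i) (e i)) + ∑ i, fsmul (c i) (e i) := by abel
  have e2 : (jetBracket J α (β - ∑ i, fsmul (c i) (e i))).1 (ι s) = 0 := by
    refine jetBracket_eq_zero_of_eventually α ?_
    filter_upwards [hc] with y hy
    rw [Submodule.coe_sub, Pi.sub_apply, jetSections_sum_apply, hy]
    exact sub_self _
  rw [e1, map_add, Submodule.coe_add, Pi.add_apply, e2, zero_add, map_sum, jetSections_sum_apply]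
  refine Finset.sum_eq_zero fun i _ => ?_
  rw [jetBracket_fsmul]
  change c i (ι s) • (jetBracket J α (e i)).1 (ι s) + (nabla J α).X (c i) (ι s) • (e i).1 (ι s) = 0
  -- The derivative of `c i` along the anchor of `α` vanishes because `c i` is zero on `S` and the
  -- anchor is tangent to `S`.
  rw [nabla_X, dAt_mem_annihilator (hc0 i) _ hα, (hc0 i).self_of_nhds, zero_smul, zero_smul, add_zero]

/-! ### Local frames of the conormal bundle. -/

/-- A derivation of functions gives, in a cut-off frame, a derivation of the line bundle. -/
theorem exists_der {c : Cₛ^∞⟮𝓘(ℝ, E); ℝ, L⟯ →ₗ[C^∞⟮𝓘(ℝ, E), M; ℝ⟯] C^∞⟮𝓘(ℝ, E), M; ℝ⟯}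
    {e : Cₛ^∞⟮𝓘(ℝ, E); ℝ, L⟯} {χ : C^∞⟮𝓘(ℝ, E), M; ℝ⟯} (hce : ∀ s, c s • e = χ • s)
    (D : C^∞⟮𝓘(ℝ, E), M; ℝ⟯ →ₗ[ℝ] C^∞⟮𝓘(ℝ, E), M; ℝ⟯) (hD : ∀ f g, D (f * g) = f * D g + g * D f) :
    ∃ Δ : Der E L, ∀ f, Δ.X f = χ * D f :=
  ⟨⟨LinearMap.mk (AddHom.mk (fun s => D (c s) • e) fun s t => by
      rw [map_add, map_add, add_smul]) fun a s => by
      change D (c (a • s)) • e = a • D (c s) • e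
      rw [LinearMap.map_smul_of_tower, map_smul, smul_assoc], fun f => χ * D f, fun f s => by
      change D (c (f • s)) • e = f • D (c s) • e + (χ * D f) • s
      rw [map_smul, smul_eq_mul, hD, add_smul, mul_smul, mul_comm (c s), mul_smul, hce, smul_smul, smul_smul,
        mul_comm (D f)]⟩, fun _ => rfl⟩

variable [FiniteDimensional ℝ E'] [IsManifold 𝓘(ℝ, E') ∞ S] [T2Space S]

/-- The annihilator of the image of an injective map has the complementary dimension. This upper
bound replaces a direct proof that the conormal jets of a frame span. -/
theorem finrank_annihilator_le {s : S} (h : Manifold.IsImmersionAt 𝓘(ℝ, E') 𝓘(ℝ, E) ∞ ι s) :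
    Module.finrank ℝ (annihilator ι s) + Module.finrank ℝ E' ≤ Module.finrank ℝ E := by
  let d : E' →ₗ[ℝ] E := (incl ι s).toLinearMap
  have hd : Function.Injective d := incl_injective ι h
  have h1 := Subspace.finrank_add_finrank_dualAnnihilator_eq (LinearMap.range d)
  rw [LinearMap.finrank_range_of_inj hd] at h1
  let A : Submodule ℝ (E →L[ℝ] ℝ) := annihilator ι s
  let q : A →ₗ[ℝ] (LinearMap.range d).dualAnnihilator :=
    LinearMap.codRestrict _ (ContinuousLinearMap.coeLM ℝ ∘ₗ A.subtype) fun ξ =>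
      (Submodule.mem_dualAnnihilator _).2 fun v hv => ξ.2 v hv
  have hq : Function.Injective q := fun ξ η hξη =>
    Subtype.ext (ContinuousLinearMap.coe_injective (congrArg Subtype.val hξη))
  have h2 : Module.finrank ℝ A ≤ _ := LinearMap.finrank_le_finrank_of_injective hq
  rw [← h1, add_comm]
  exact Nat.add_le_add_left h2 _

/-- Local frames of the conormal bundle, by jets of sections that vanish on `S`. -/
theorem exists_conormal_frame (hι : ∀ s, Manifold.IsImmersionAt 𝓘(ℝ, E') 𝓘(ℝ, E) ∞ ι s) (s : S) :
    ∃ (n : ℕ) (b : Fin n → Cₛ^∞⟮𝓘(ℝ, E); ℝ, L⟯), (∀ᶠ t in 𝓝 s, ∀ i, b i (ι t) = 0) ∧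
      (∀ᶠ t in 𝓝 s, LinearIndependent ℝ (fun i => jet E L (ι t) (b i)) ∧
        Submodule.span ℝ (Set.range fun i => jet E L (ι t) (b i)) = conormal L ι t) ∧
      ∀ α : jetSections E L, (∀ᶠ t in 𝓝 s, α.1 (ι t) ∈ conormal L ι t) →
        ∃ a : Fin n → C^∞⟮𝓘(ℝ, E), M; ℝ⟯, ∀ᶠ t in 𝓝 s, α.1 (ι t) = ∑ i, a i (ι t) • jet E L (ι t) (b i) := by
  obtain ⟨n, g, D, hn, hg, hD, hDg⟩ := exists_slice ι (hι s)
  obtain ⟨c, e, χ, hχ, hce, he, -⟩ := exists_frame E L (ι s)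
  choose Δ hΔ using fun j => exists_der (L := L) hce (D j) (hD j)
  have hcont : ContinuousAt ι s := ι.contMDiff.continuous.continuousAt
  have hb : ∀ᶠ t in 𝓝 s, ∀ i, (g i • e) (ι t) = 0 := by
    filter_upwards [hg] with t ht i
    rw [smul_section_apply, ht, zero_smul]
  -- The derivations `Δ j` are dual to the jets of `g i • e` along `S`. This yields their
  -- independence and also reads off the coefficients of a conormal section.
  have hpair : ∀ᶠ t in 𝓝 s, ∀ (r : Fin n → ℝ) j,
      jetPair (∑ i, r i • jet E L (ι t) (g i • e)) ((Δ j).at (ι t)) = r j • e (ι t) := by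
    filter_upwards [hg, hcont.eventually hχ, hcont.eventually hDg] with t h1 h2 h3 r j
    have h4 : ∀ i, jetPair (jet E L (ι t) (g i • e)) ((Δ j).at (ι t)) = (if i = j then (1 : ℝ) else 0) • e (ι t) := by
      intro i
      rw [jetPair_jet, Der.at_apply, Der.op_smul_apply, h1, zero_smul, zero_add, hΔ, ContMDiffMap.coe_mul,
        Pi.mul_apply, h2, h3, one_mul]
    have h5 : jetPair (∑ i, r i • jet E L (ι t) (g i • e)) ((Δ j).at (ι t)) =
        ∑ i, r i • jetPair (jet E L (ι t) (g i • e)) ((Δ j).at (ι t)) := by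
      change jetLift ((Δ j).at (ι t)).1 _ _ = _
      rw [map_sum]
      exact Finset.sum_congr rfl fun k _ => map_smul _ _ _
    rw [h5]
    simp [h4, ite_smul]
  have hframe : ∀ᶠ t in 𝓝 s, LinearIndependent ℝ (fun i => jet E L (ι t) (g i • e)) ∧
      Submodule.span ℝ (Set.range fun i => jet E L (ι t) (g i • e)) = conormal L ι t := by
    filter_upwards [hpair, hb.eventually_nhds, hcont.eventually hχ, hcont.eventually he] with t h1 h2 h3 h4
    have hli : LinearIndependent ℝ (fun i => jet E L (ι t) (g i • e)) := by
      refine Fintype.linearIndependent_iff.2 fun r hr j => ?_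
      have h5 := h1 r j
      rw [hr] at h5
      exact (smul_eq_zero.1 (h5.symm.trans (map_zero _))).resolve_right h4
    refine ⟨hli, ?_⟩
    -- Since `L` has rank one, each `ξ ⊗ w` can be written as `ξ' ⊗ e`; so the conormal fibre has at
    -- most the dimension of the annihilator.
    have h6 : conormal L ι t ≤ (annihilator ι t).map ((cosymbol E L (ι t)).flip (e (ι t))) := by
      refine Submodule.map₂_le.2 fun ξ hξ w _ => ?_
      obtain ⟨u, rfl⟩ := exists_section (E := E) (ι t) w
      refine ⟨c u (ι t) • ξ, Submodule.smul_mem _ _ hξ, ?_⟩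
      rw [map_smul, LinearMap.flip_apply, ← map_smul, frame_coeff hce h3]
    have i1 : FiniteDimensional ℝ (TangentSpace 𝓘(ℝ, E) (ι t) →L[ℝ] ℝ) :=
      inferInstanceAs (FiniteDimensional ℝ (E →L[ℝ] ℝ))
    have i2 : FiniteDimensional ℝ (conormal L ι t) := Submodule.finiteDimensional_of_le h6
    -- The span lies in the conormal fibre, and its dimension `n`, the codimension of `S`, is
    -- already the largest possible.
    refine Submodule.eq_of_le_of_finrank_le (Submodule.span_le.2 ?_) ?_
    · rintro _ ⟨i, rfl⟩
      exact jet_mem_conormal (h2.mono fun _ h => h i)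
    · rw [finrank_span_eq_card hli, Fintype.card_fin]
      have h7 := (Submodule.finrank_mono h6).trans (Submodule.finrank_map_le _ _)
      have h8 := finrank_annihilator_le (hι t)
      omega
  -- Pairing `α` with `Δ j` on all of `M` gives smooth coefficients on `M`, although the expansion
  -- is claimed along `S` only. The Leibniz rule for the bracket needs such functions.
  refine ⟨n, fun i => g i • e, hb, hframe, fun α hα => ⟨fun j => c (pairS α (Δ j)), ?_⟩⟩
  filter_upwards [hα, hpair, hframe, hcont.eventually hχ, hcont.eventually he] with t h1 h2 h3 h4 h5
  rw [← h3.2] at h1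
  obtain ⟨r, hr⟩ := (Submodule.mem_span_range_iff_exists_fun ℝ).1 h1
  have h6 : ∀ j, c (pairS α (Δ j)) (ι t) = r j := fun j => by
    refine smul_left_injective ℝ h5 ?_
    change c (pairS α (Δ j)) (ι t) • e (ι t) = r j • e (ι t)
    rw [frame_coeff hce h4, pairS_apply, ← hr, h2]
  rw [← hr]
  exact Finset.sum_congr rfl fun j _ => by rw [h6]

/-! ### Closure of conormal sections under the bracket. -/

/-- Sections that are conormal along a coisotropic submanifold are closed under the bracket. -/
theorem jetBracket_mem_conormal (hι : ∀ s, Manifold.IsImmersionAt 𝓘(ℝ, E') 𝓘(ℝ, E) ∞ ι s)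
    (hJ : IsCoisotropic J ι) {s : S} {α α' : jetSections E L}
    (hα : ∀ᶠ t in 𝓝 s, α.1 (ι t) ∈ conormal L ι t) (hα' : ∀ᶠ t in 𝓝 s, α'.1 (ι t) ∈ conormal L ι t) :
    (jetBracket J α α').1 (ι s) ∈ conormal L ι s := by
  obtain ⟨n, b, hb, -, hcoeff⟩ := exists_conormal_frame (L := L) hι s
  have hbi : ∀ i, ∀ᶠ t in 𝓝 s, b i (ι t) = 0 := fun i => hb.mono fun _ h => h i
  have hbc : ∀ i, ∀ᶠ t in 𝓝 s, jet E L (ι t) (b i) ∈ conormal L ι t := fun i =>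
    (hbi i).eventually_nhds.mono fun _ h => jet_mem_conormal h
  -- Expanding the second argument in the frame reduces to frame elements: the remainder vanishes
  -- along `S` and contributes nothing, and the derivatives of the coefficients multiply conormal
  -- jets. By skew-symmetry the same reduction then serves for the first argument.
  have key : ∀ β : jetSections E L, β.1 (ι s) ∈ conormal L ι s →
      (∀ i, (jetBracket J β (jetProlong E L (b i))).1 (ι s) ∈ conormal L ι s) →
      ∀ β' : jetSections E L, (∀ᶠ t in 𝓝 s, β'.1 (ι t) ∈ conormal L ι t) →
        (jetBracket J β β').1 (ι s) ∈ conormal L ι s := by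
    intro β hβ hβb β' hβ'
    obtain ⟨a, ha⟩ := hcoeff β' hβ'
    have e1 : β' = (β' - ∑ i, fsmul (a i) (jetProlong E L (b i))) + ∑ i, fsmul (a i) (jetProlong E L (b i)) := by
      abel
    have e2 : (jetBracket J β (β' - ∑ i, fsmul (a i) (jetProlong E L (b i)))).1 (ι s) = 0 := by
      refine jetBracket_eq_zero (anchor_mem_tangent hJ hβ) ?_
      filter_upwards [ha] with t ht
      rw [Submodule.coe_sub, Pi.sub_apply, jetSections_sum_apply, ht]
      exact sub_self _
    rw [e1, map_add, Submodule.coe_add, Pi.add_apply, e2, zero_add, map_sum, jetSections_sum_apply]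
    refine sum_mem fun i _ => ?_
    rw [jetBracket_fsmul]
    exact add_mem (Submodule.smul_mem _ _ (hβb i)) (Submodule.smul_mem _ _ (hbc i).self_of_nhds)
  refine key α hα.self_of_nhds (fun i => ?_) α' hα'
  rw [jetBracket_skew]
  refine neg_mem (key _ (hbc i).self_of_nhds (fun j => ?_) α hα)
  -- What remains is `j¹{b_i, b_j}`, and isotropy makes `{b_i, b_j}` vanish on `S` near `s`.
  rw [jetBracket_jet]
  refine jet_mem_conormal ?_
  filter_upwards [hbc i, hbc j] with t h1 h2
  exact lambdaHat_conormal hJ h1 h2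

/-! ### Extension of sections of `ℓ`, and the induced derivations. -/

/-- Locally, sections of `ℓ = L|_S` extend. -/
theorem exists_section_extension {s : S} (hι : Manifold.IsImmersionAt 𝓘(ℝ, E') 𝓘(ℝ, E) ∞ ι s)
    (ε : Cₛ^∞⟮𝓘(ℝ, E'); ℝ, (ι : S → M) *ᵖ L⟯) :
    ∃ u : Cₛ^∞⟮𝓘(ℝ, E); ℝ, L⟯, ∀ᶠ t in 𝓝 s, restrict ι u t = ε t := by
  obtain ⟨c, e, χ, hχ, hce, he, -⟩ := exists_frame E' ((ι : S → M) *ᵖ L) s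
  obtain ⟨-, e', -, -, -, he', -⟩ := exists_frame E L (ι s)
  have hr : c (restrict ι e') s ≠ 0 := by
    intro h0
    have h1 := frame_coeff hce hχ.self_of_nhds (restrict ι e')
    rw [h0, zero_smul] at h1
    exact he'.self_of_nhds h1.symm
  -- The restriction of `e'` is a local frame of `ℓ`, and `c ε * d` is the coefficient of `ε` in it.
  -- Only this function has to be extended.
  obtain ⟨d, hd⟩ := exists_local_inv (c (restrict ι e')) hr
  obtain ⟨F, hF⟩ := exists_extension ι hι (c ε * d)
  refine ⟨F • e', ?_⟩
  filter_upwards [hF, hd, hχ] with t h1 h2 h3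
  have h4 : restrict ι (F • e') t = F (ι t) • restrict ι e' t := rfl
  rw [h4, h1, ← frame_coeff hce h3 (restrict ι e'), ← frame_coeff hce h3 ε, smul_smul, ContMDiffMap.coe_mul,
    Pi.mul_apply, mul_assoc, h2, mul_one]

/-- Conormal elements act as derivations of `ℓ = L|_S`, if `S` is coisotropic. -/
theorem exists_conormal_der (hJ : IsCoisotropic J ι) {s : S}
    (hι : Manifold.IsImmersionAt 𝓘(ℝ, E') 𝓘(ℝ, E) ∞ ι s) :
    ∃ D : conormal L ι s →ₗ[ℝ] derFiber E' ((ι : S → M) *ᵖ L) s, ∀ b ε u,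
      (∀ᶠ t in 𝓝 s, restrict ι u t = ε t) → (D b).1 ε = (sharpHat J (ι s) b.1).1 u := by
  choose x hx using fun ε => exists_section_extension (L := L) hι ε
  -- Independence of the extension: the difference of two extensions vanishes on `S` near `s`.
  -- Linearity and the Leibniz rule follow, because the chosen extension `x` respects sums and
  -- products along `S`.
  have key : ∀ b : conormal L ι s, ∀ u v : Cₛ^∞⟮𝓘(ℝ, E); ℝ, L⟯,
      (∀ᶠ t in 𝓝 s, restrict ι u t = restrict ι v t) →
      (sharpHat J (ι s) b.1).1 u = (sharpHat J (ι s) b.1).1 v := by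
    intro b u v h
    rw [← sub_eq_zero, ← map_sub]
    refine sharpHat_eq_zero hJ b.2 (h.mono fun t ht => ?_)
    exact sub_eq_zero.2 ht
  let δ : conormal L ι s → Cₛ^∞⟮𝓘(ℝ, E'); ℝ, (ι : S → M) *ᵖ L⟯ →ₗ[ℝ] ((ι : S → M) *ᵖ L) s := fun b =>
    { toFun := fun ε => (sharpHat J (ι s) b.1).1 (x ε)
      map_add' := fun ε ε' => by
        refine (key b _ (x ε + x ε') ?_).trans (map_add _ _ _)
        filter_upwards [hx (ε + ε'), hx ε, hx ε'] with t h1 h2 h3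
        rw [h1, map_add]
        exact (congrArg₂ (· + ·) h2 h3).symm
      map_smul' := fun r ε => by
        refine (key b _ (r • x ε) ?_).trans (map_smul _ _ _)
        filter_upwards [hx (r • ε), hx ε] with t h1 h2
        rw [h1, map_smul]
        exact (congrArg (r • ·) h2).symm }
  have hδ : ∀ b, δ b ∈ derFiber E' ((ι : S → M) *ᵖ L) s := by
    intro b
    obtain ⟨v, hv⟩ := anchor_mem_tangent hJ b.2
    -- The symbol is the vector `v` of `S` whose image in `M` is the anchor of `b`; for an extension
    -- `F` of `f`, the Leibniz rule for `F` on `M` restricts to that for `f` on `S`.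
    refine ⟨v, fun f ε => ?_⟩
    obtain ⟨F, hF⟩ := exists_extension ι hι f
    have h1 : (sharpHat J (ι s) b.1).1 (x (f • ε)) = (sharpHat J (ι s) b.1).1 (F • x ε) := by
      refine key b _ _ ?_
      filter_upwards [hx (f • ε), hx ε, hF] with t h1 h2 h3
      have h4 : restrict ι (F • x ε) t = F (ι t) • restrict ι (x ε) t := rfl
      rw [h1, h4, h2, h3]
      rfl
    have h2 : dAt (F.comp ι) s = dAt f s := dAt_congr hF
    have h3 : dAt F (ι s) (symbol E L (ι s) (sharpHat J (ι s) b.1)) = dAt f s v := by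
      rw [← hv, ← h2, dAt_comp]; rfl
    have h4 := der_smul (sharpHat J (ι s) b.1) F (x ε)
    rw [h3, hF.self_of_nhds] at h4
    have h5 : x ε (ι s) = ε s := (hx ε).self_of_nhds
    rw [h5] at h4
    exact h1.trans h4
  refine ⟨LinearMap.codRestrict _
    { toFun := δ
      map_add' := fun a b => by
        ext ε
        change (sharpHat J (ι s) (a.1 + b.1)).1 (x ε) = _
        rw [map_add]; rfl
      map_smul' := fun r b => by
        ext ε
        change (sharpHat J (ι s) (r • b.1)).1 (x ε) = _
        rw [map_smul]; rfl } hδ, fun b ε u hu => key b _ _ ?_⟩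
  filter_upwards [hx ε, hu] with t h1 h2
  rw [h1, h2]

end Conormal

/-! ### The two implications, condition by condition. -/

section Proposition

variable {E : Type*} [NormedAddCommGroup E] [NormedSpace ℝ E] [FiniteDimensional ℝ E]
  {M : Type*} [TopologicalSpace M] [ChartedSpace E M] [IsManifold 𝓘(ℝ, E) ∞ M] [T2Space M]
  {L : M → Type*} [TopologicalSpace (TotalSpace ℝ L)] [∀ x, AddCommGroup (L x)]
  [∀ x, Module ℝ (L x)] [∀ x, TopologicalSpace (L x)] [FiberBundle ℝ L] [VectorBundle ℝ ℝ L]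
  [ContMDiffVectorBundle ∞ ℝ L 𝓘(ℝ, E)]
  {E' : Type*} [NormedAddCommGroup E'] [NormedSpace ℝ E']
  {S : Type*} [TopologicalSpace S] [ChartedSpace E' S]
  {ι : C^∞⟮𝓘(ℝ, E'), S; 𝓘(ℝ, E), M⟯} {J : JacobiStructure E L}

/-- The anchor condition alone suffices: `ρB` exhibits `Λ_J^♯(ξ ⊗ w)` as the image of a tangent
vector of `S`. -/
theorem isCoisotropic_of_subalgebroid (h : IsJacobiSubalgebroid (jetAlgebroid J) ι (conormal L ι)) :
    IsCoisotropic J ι := by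
  obtain ⟨ρ, hρ, -⟩ := h.anchor
  exact fun s ξ hξ w => ⟨ρ s ⟨_, cosymbol_mem_conormal hξ w⟩, hρ s ⟨_, cosymbol_mem_conormal hξ w⟩⟩

variable [FiniteDimensional ℝ E'] [IsManifold 𝓘(ℝ, E') ∞ S] [T2Space S]

theorem conormal_isSubbundle (hι : ∀ s, Manifold.IsImmersionAt 𝓘(ℝ, E') 𝓘(ℝ, E) ∞ ι s) :
    IsSubbundle (jetSections E L) ι (conormal L ι) := fun s => by
  obtain ⟨n, b, -, hb, -⟩ := exists_conormal_frame (L := L) hι s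
  exact ⟨n, fun i t => jet E L (ι t) (b i), fun i _ =>
    ⟨_, (jetProlong E L (b i)).2, Filter.Eventually.of_forall fun _ => rfl⟩, hb⟩

/-- The anchor is composed with the inverse of the differential of `ι` on its image. For smoothness,
the derivative of `f` along the result is, near each point, the restriction to `S` of the derivative
of an extension `F` along the anchor of an extension of `β`. -/
theorem conormal_anchor (hι : ∀ s, Manifold.IsImmersionAt 𝓘(ℝ, E') 𝓘(ℝ, E) ∞ ι s) (hJ : IsCoisotropic J ι) :
    ∃ ρB : ∀ s, conormal L ι s →ₗ[ℝ] TangentSpace 𝓘(ℝ, E') s,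
      (∀ s b, incl ι s (ρB s b) = (jetAlgebroid J).anchor (ι s) b.1) ∧
      ∀ (β : ∀ s, JetFiber E L (ι s)) (hβ : IsSection (jetSections E L) ι (conormal L ι) β)
        (f : C^∞⟮𝓘(ℝ, E'), S; ℝ⟯),
        ContMDiff 𝓘(ℝ, E') 𝓘(ℝ, ℝ) ∞ fun s => dAt f s (ρB s ⟨β s, hβ.2 s⟩) := by
  let q := fun s => LinearEquiv.ofInjective (incl ι s).toLinearMap (incl_injective ι (hι s))
  let ρ : ∀ s, conormal L ι s →ₗ[ℝ] TangentSpace 𝓘(ℝ, E') s := fun s =>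
    (q s).symm.toLinearMap ∘ₗ LinearMap.codRestrict (tangent ι s)
      (symbol E L (ι s) ∘ₗ sharpHat J (ι s) ∘ₗ (conormal L ι s).subtype) fun b => anchor_mem_tangent hJ b.2
  have hρ : ∀ s b, incl ι s (ρ s b) = (jetAlgebroid J).anchor (ι s) b.1 := fun s b =>
    congrArg Subtype.val ((q s).apply_symm_apply _)
  refine ⟨ρ, hρ, fun β hβ f s => ?_⟩
  obtain ⟨α, hα, hαβ⟩ := hβ.1 s
  obtain ⟨F, hF⟩ := exists_extension ι (hι s) f
  refine ((((nabla J ⟨α, hα⟩).X F).comp ι).contMDiff s).congr_of_eventuallyEq ?_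
  filter_upwards [hαβ, hF.eventually_nhds] with t h1 h2
  have h3 : dAt (F.comp ι) t = dAt f t := dAt_congr h2
  rw [← h3, dAt_comp, hρ]
  change dAt F (ι t) (symbol E L (ι t) (sharpHat J (ι t) (β t))) =
    dAt F (ι t) (symbol E L (ι t) (sharpHat J (ι t) (α (ι t))))
  rw [h1]

/-- Along a coisotropic submanifold, the bracket of conormal sections depends on their restrictions only. -/
theorem jetBracket_congr (hJ : IsCoisotropic J ι) {s : S} {α₁ α₂ α₁' α₂' : jetSections E L}
    (h : ∀ᶠ t in 𝓝 s, α₁.1 (ι t) = α₂.1 (ι t)) (h' : ∀ᶠ t in 𝓝 s, α₁'.1 (ι t) = α₂'.1 (ι t))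
    (hα : α₁.1 (ι s) ∈ conormal L ι s) (hα' : α₁'.1 (ι s) ∈ conormal L ι s) :
    (jetBracket J α₁ α₁').1 (ι s) = (jetBracket J α₂ α₂').1 (ι s) := by
  have h1 : (jetBracket J α₁' (α₁ - α₂)).1 (ι s) = 0 :=
    jetBracket_eq_zero (anchor_mem_tangent hJ hα') (h.mono fun t ht => sub_eq_zero.2 ht)
  have h2 : (jetBracket J α₂ (α₁' - α₂')).1 (ι s) = 0 :=
    jetBracket_eq_zero (anchor_mem_tangent hJ (h.self_of_nhds ▸ hα)) (h'.mono fun t ht => sub_eq_zero.2 ht)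
  rw [map_sub] at h1 h2
  -- The two arguments are exchanged one at a time. The argument held fixed has tangent anchor at
  -- `s`: it is `α₁'` at one exchange and `α₂`, which agrees with `α₁` at `s`, at the other.
  rw [jetBracket_skew J α₁, ← sub_eq_zero.1 h2, jetBracket_skew J α₂]
  exact congrArg Neg.neg (sub_eq_zero.1 h1)

/-- A section along `S` is only assumed to extend locally, so the bracket is assembled from local
extensions. `jetBracket_congr` makes it independent of them, which gives both smoothness and
agreement with any global extensions. -/
theorem conormal_bracket (hι : ∀ s, Manifold.IsImmersionAt 𝓘(ℝ, E') 𝓘(ℝ, E) ∞ ι s) (hJ : IsCoisotropic J ι)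
    (β β' : ∀ s, JetFiber E L (ι s)) (hβ : IsSection (jetSections E L) ι (conormal L ι) β)
    (hβ' : IsSection (jetSections E L) ι (conormal L ι) β') :
    ∃ γ : ∀ s, JetFiber E L (ι s), IsSection (jetSections E L) ι (conormal L ι) γ ∧
      ∀ α α' : jetSections E L, (∀ s, α.1 (ι s) = β s) → (∀ s, α'.1 (ι s) = β' s) →
        ∀ s, (jetBracket J α α').1 (ι s) = γ s := by
  choose α hα hαβ using hβ.1
  choose α' hα' hαβ' using hβ'.1
  have hmem : ∀ s, ∀ᶠ t in 𝓝 s, α s (ι t) ∈ conormal L ι t := fun s =>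
    (hαβ s).mono fun t ht => ht ▸ hβ.2 t
  have hmem' : ∀ s, ∀ᶠ t in 𝓝 s, α' s (ι t) ∈ conormal L ι t := fun s =>
    (hαβ' s).mono fun t ht => ht ▸ hβ'.2 t
  refine ⟨fun s => (jetBracket J ⟨α s, hα s⟩ ⟨α' s, hα' s⟩).1 (ι s),
    ⟨fun s => ⟨_, (jetBracket J ⟨α s, hα s⟩ ⟨α' s, hα' s⟩).2, ?_⟩,
      fun s => jetBracket_mem_conormal hι hJ (hmem s) (hmem' s)⟩, fun η η' h h' s => ?_⟩
  -- At a nearby point `t` the value was defined by the extensions chosen at `t`; along `S` near `t`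
  -- they agree with those chosen at `s`, so one smooth section represents the bracket around `s`.
  · filter_upwards [(hαβ s).eventually_nhds, (hαβ' s).eventually_nhds] with t h1 h2
    refine jetBracket_congr hJ ?_ ?_ (hmem t).self_of_nhds (hmem' t).self_of_nhds
    · filter_upwards [h1, hαβ t] with r h3 h4
      exact h4.symm.trans h3
    · filter_upwards [h2, hαβ' t] with r h3 h4
      exact h4.symm.trans h3
  · refine jetBracket_congr hJ ?_ ?_ ((h s).symm ▸ hβ.2 s) ((h' s).symm ▸ hβ'.2 s)
    · filter_upwards [hαβ s] with t ht
      exact (h t).trans ht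
    · filter_upwards [hαβ' s] with t ht
      exact (h' t).trans ht

/-- `exists_conormal_der` computes the derivation from any local extension of `ε`. Compatibility
with `derPush` uses `u` as an extension of its own restriction; smoothness uses one extension for
all points near `s`. -/
theorem conormal_conn (hι : ∀ s, Manifold.IsImmersionAt 𝓘(ℝ, E') 𝓘(ℝ, E) ∞ ι s) (hJ : IsCoisotropic J ι) :
    ∃ D : ∀ s, conormal L ι s →ₗ[ℝ] derFiber E' ((ι : S → M) *ᵖ L) s,
      (∀ s b, derPush L ι s (D s b) = (jetAlgebroid J).conn (ι s) b.1) ∧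
      ∀ (β : ∀ s, JetFiber E L (ι s)) (hβ : IsSection (jetSections E L) ι (conormal L ι) β)
        (ε : Cₛ^∞⟮𝓘(ℝ, E'); ℝ, (ι : S → M) *ᵖ L⟯),
        ContMDiff 𝓘(ℝ, E') (𝓘(ℝ, E').prod 𝓘(ℝ, ℝ)) ∞ fun s =>
          (TotalSpace.mk' ℝ s ((D s ⟨β s, hβ.2 s⟩).1 ε) : TotalSpace ℝ ((ι : S → M) *ᵖ L)) := by
  choose D hD using fun s => exists_conormal_der hJ (hι s)
  refine ⟨D, fun s b => Subtype.ext (LinearMap.ext fun u => ?_), fun β hβ ε s => ?_⟩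
  · exact hD s b (restrict ι u) u (Filter.Eventually.of_forall fun _ => rfl)
  · obtain ⟨α, hα, hαβ⟩ := hβ.1 s
    obtain ⟨u, hu⟩ := exists_section_extension (L := L) (hι s) ε
    -- Near `s` the derivative of `ε` along `β` is the restriction of `∇_α u`, where `α` and `u`
    -- extend `β` and `ε`.
    refine ((restrict ι ((nabla J ⟨α, hα⟩).op u)).contMDiff s).congr_of_eventuallyEq ?_
    filter_upwards [hαβ, hu.eventually_nhds] with t h1 h2
    have h3 : (D t ⟨β t, hβ.2 t⟩).1 ε = restrict ι ((nabla J ⟨α, hα⟩).op u) t := by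
      rw [hD t _ ε u h2, restrict_apply, nabla_apply]
      simp only [h1]
      rfl
    rw [h3]

end Proposition

end Jac
end

theorem proposition3p4
    {E : Type*} [NormedAddCommGroup E] [NormedSpace ℝ E] [FiniteDimensional ℝ E]
    {M : Type*} [TopologicalSpace M] [ChartedSpace E M] [IsManifold 𝓘(ℝ, E) ∞ M] [T2Space M]
    {L : M → Type*} [TopologicalSpace (TotalSpace ℝ L)] [∀ x, AddCommGroup (L x)]
    [∀ x, Module ℝ (L x)] [∀ x, TopologicalSpace (L x)] [FiberBundle ℝ L] [VectorBundle ℝ ℝ L]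
    [ContMDiffVectorBundle ∞ ℝ L 𝓘(ℝ, E)]
    (J : Jac.JacobiStructure E L)
    {E' : Type*} [NormedAddCommGroup E'] [NormedSpace ℝ E'] [FiniteDimensional ℝ E']
    {S : Type*} [TopologicalSpace S] [ChartedSpace E' S] [IsManifold 𝓘(ℝ, E') ∞ S]
    (ι : C^∞⟮𝓘(ℝ, E'), S; 𝓘(ℝ, E), M⟯)
    (hι : Manifold.IsSmoothEmbedding 𝓘(ℝ, E') 𝓘(ℝ, E) ∞ ι) :
    Jac.IsCoisotropic J ι ↔
      Jac.IsJacobiSubalgebroid (Jac.jetAlgebroid J) ι (Jac.conormal L ι) := by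
  -- Bump functions on `S`, used for frames of `ℓ` and for separating tangent vectors, need `S` to
  -- be Hausdorff; an embedding into `M` provides this.
  have : T2Space S := hι.isEmbedding.t2Space
  have him : ∀ s, Manifold.IsImmersionAt 𝓘(ℝ, E') 𝓘(ℝ, E) ∞ ι s := hι.isImmersion.isImmersionAt
  exact ⟨fun hJ => ⟨Jac.conormal_isSubbundle him, Jac.conormal_anchor him hJ, Jac.conormal_bracket him hJ,
    Jac.conormal_conn him hJ⟩, Jac.isCoisotropic_of_subalgebroid⟩
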